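/- \textbf{Theorem.} In \textsc{Diverse Multistage Plurality Voting}, an instance $J$ consists of a finite set $A$ of agents, a finite set $C$ of candidates, a sequence $u_1,\dots,u_\tau\colon A\to C\cup\{\emptyset\}$ of voting profiles (where $u_i(a)=\emptyset$ means that agent $a$ votes for no candidate), and integers $k,x,\ell\ge 0$. The question is whether there are committees $C_1,\dots,C_\tau\subseteq C$ such that $|C_i|\le k$ and $|u_i^{-1}(C_i)|\ge x$ for all $i\in\{1,\dots,\tau\}$, and $|C_i\,\Delta\,C_{i+1}|\ge \ell$ for all $i\in\{1,\dots,\tau-1\}$, where $\Delta$ is the symmetric difference. Let $|J|$ be the length of the encoding of $J$ in which $A$, $C$ and the profiles are listed explicitly and numbers are written in binary. Then there is a deterministic algorithm that decides every instance $J$ in $2^{O(\ell)}\cdot|J|^{O(1)}$ time. Moreover, there is a deterministic algorithm that decides every instance $J$ in $2^{O(k)}\cdot|J|^{O(1)}$ time. In particular, the problem is fixed-parameter tractable both when parameterized by $\ell$ and when parameterized by $k$, which answers an open question of Bredereck et al. (Running time is measured on a random access machine with addition and subtraction under the logarithmic cost criterion, which is polynomially equivalent to Turing machines.) -/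

import Mathlib

/-! ### Diverse Multistage Plurality Voting -/

/-- `S` is a feasible sequence of committees for the voting profiles `u 0, …, u (τ - 1)`
(`u i v = none` means that agent `v` votes for nobody in profile `i`): every committee has at most
`k` members and at least `x` votes, and consecutive committees differ in at least `ℓ` candidates. -/
def IsDiverseCommitteeSequence {A C : Type*} [Fintype A] [DecidableEq C] {τ : ℕ}
    (u : Fin τ → A → Option C) (k x ℓ : ℕ) (S : Fin τ → Finset C) : Prop :=
  (∀ i, (S i).card ≤ k ∧ x ≤ (Finset.univ.filter fun v : A => ∃ c ∈ S i, u i v = some c).card) ∧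
    ∀ i j : Fin τ, (j : ℕ) = (i : ℕ) + 1 → ℓ ≤ (symmDiff (S i) (S j)).card

/-- An instance. The finite sets of agents and of candidates are numbered, so that an instance can
be the input of a program. -/
structure VotingInstance where
  numAgents : ℕ
  numCandidates : ℕ
  numProfiles : ℕ
  profile : Fin numProfiles → Fin numAgents → Option (Fin numCandidates)
  k : ℕ
  x : ℕ
  ℓ : ℕ

namespace VotingInstance

/-- The question of the decision problem. -/
def IsYes (J : VotingInstance) : Prop :=
  ∃ S : Fin J.numProfiles → Finset (Fin J.numCandidates),
    IsDiverseCommitteeSequence J.profile J.k J.x J.ℓ S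

/-- The `c`-th candidate is named `c + 1`; the name `0` stands for "no vote". -/
def voteCode {m : ℕ} : Option (Fin m) → ℕ
  | none => 0
  | some c => (c : ℕ) + 1

/-- The instance as a sequence of natural numbers: the three cardinalities and `k, x, ℓ`, then the
explicit lists of all agents, all candidates and all profile indices, and then, profile after
profile, the votes of all agents. -/
def encode (J : VotingInstance) : List ℕ :=
  [J.numAgents, J.numCandidates, J.numProfiles, J.k, J.x, J.ℓ]
    ++ List.range' 1 J.numAgents ++ List.range' 1 J.numCandidates ++ List.range' 1 J.numProfiles
    ++ (List.ofFn fun i => List.ofFn fun v => voteCode (J.profile i v)).flatten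

end VotingInstance

/-- The length of a sequence of natural numbers as a word: every number is written in binary and
followed by a separator. -/
def wordLength (w : List ℕ) : ℕ := (w.map fun n => Nat.size n + 1).sum

/-- The input size `|J|`. -/
def VotingInstance.size (J : VotingInstance) : ℕ := wordLength J.encode

/-! ### Random access machines with logarithmic cost

A program is a finite structured program over integer variables and arrays (finitely many occur in
it). Its only arithmetic operations are addition and truncated subtraction. Every elementary
operation is charged one plus the bit lengths of all the numbers that it handles (addresses
included), so that running times agree up to a polynomial with those of Turing machines. -/

inductive RamProgram where
  | skip
  /-- `x := n` -/
  | const (x n : ℕ)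
  /-- `x := y` -/
  | copy (x y : ℕ)
  /-- `x := y + z` -/
  | add (x y z : ℕ)
  /-- `x := max (y - z) 0` -/
  | sub (x y z : ℕ)
  /-- `x := a[y]` -/
  | load (x a y : ℕ)
  /-- `a[y] := z` -/
  | store (a y z : ℕ)
  | seq (P Q : RamProgram)
  /-- `if x ≠ 0 then P else Q` -/
  | cond (x : ℕ) (P Q : RamProgram)
  /-- `while x ≠ 0 do P` -/
  | loop (x : ℕ) (P : RamProgram)

/-- The contents of all variables and of all array cells. -/
structure RamState where
  var : ℕ → ℕ
  arr : ℕ → ℕ → ℕ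

namespace RamState

def setVar (s : RamState) (x n : ℕ) : RamState :=
  { s with var := Function.update s.var x n }

def setArr (s : RamState) (a i n : ℕ) : RamState :=
  { s with arr := Function.update s.arr a (Function.update (s.arr a) i n) }

/-- Initially array `0` holds the input, variable `0` its number of entries, and everything else
is `0`. -/
def init (w : List ℕ) : RamState where
  var := fun x => if x = 0 then w.length else 0
  arr := fun a i => if a = 0 then w.getD i 0 else 0

end RamState

/-- `RamExec P s t s'`: started in state `s`, the program `P` halts in state `s'`, and the total
cost of all the operations that it executes is `t`. -/
inductive RamExec : RamProgram → RamState → ℕ → RamState → Prop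
  | skip (s : RamState) : RamExec .skip s 1 s
  | const (s : RamState) (x n : ℕ) :
      RamExec (.const x n) s (1 + n.size) (s.setVar x n)
  | copy (s : RamState) (x y : ℕ) :
      RamExec (.copy x y) s (1 + (s.var y).size) (s.setVar x (s.var y))
  | add (s : RamState) (x y z : ℕ) :
      RamExec (.add x y z) s (1 + (s.var y).size + (s.var z).size)
        (s.setVar x (s.var y + s.var z))
  | sub (s : RamState) (x y z : ℕ) :
      RamExec (.sub x y z) s (1 + (s.var y).size + (s.var z).size)
        (s.setVar x (s.var y - s.var z))
  | load (s : RamState) (x a y : ℕ) :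
      RamExec (.load x a y) s (1 + (s.var y).size + (s.arr a (s.var y)).size)
        (s.setVar x (s.arr a (s.var y)))
  | store (s : RamState) (a y z : ℕ) :
      RamExec (.store a y z) s (1 + (s.var y).size + (s.var z).size)
        (s.setArr a (s.var y) (s.var z))
  | seq {P Q : RamProgram} {s s' s'' : RamState} {t t' : ℕ} :
      RamExec P s t s' → RamExec Q s' t' s'' → RamExec (.seq P Q) s (t + t') s''
  | condTrue {x : ℕ} {P Q : RamProgram} {s s' : RamState} {t : ℕ} :
      s.var x ≠ 0 → RamExec P s t s' →
        RamExec (.cond x P Q) s (1 + (s.var x).size + t) s'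
  | condFalse {x : ℕ} {P Q : RamProgram} {s s' : RamState} {t : ℕ} :
      s.var x = 0 → RamExec Q s t s' →
        RamExec (.cond x P Q) s (1 + (s.var x).size + t) s'
  | loopStop {x : ℕ} {P : RamProgram} {s : RamState} :
      s.var x = 0 → RamExec (.loop x P) s (1 + (s.var x).size) s
  | loopStep {x : ℕ} {P : RamProgram} {s s' s'' : RamState} {t t' : ℕ} :
      s.var x ≠ 0 → RamExec P s t s' → RamExec (.loop x P) s' t' s'' →
        RamExec (.loop x P) s (1 + (s.var x).size + t + t') s''

/-- Programs are deterministic: the final state and the cost are unique. -/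
theorem RamExec.unique {P : RamProgram} {s s₁ : RamState} {t₁ : ℕ} (h₁ : RamExec P s t₁ s₁) :
    ∀ {t₂ : ℕ} {s₂ : RamState}, RamExec P s t₂ s₂ → t₁ = t₂ ∧ s₁ = s₂ := by
  induction h₁ with
  | seq _ _ ih ih' =>
    intro _ _ h₂
    cases h₂ with
    | seq h h' => obtain ⟨rfl, rfl⟩ := ih h; obtain ⟨rfl, rfl⟩ := ih' h'; exact ⟨rfl, rfl⟩
  | condTrue hx _ ih =>
    intro _ _ h₂
    cases h₂ with
    | condTrue _ h => obtain ⟨rfl, rfl⟩ := ih h; exact ⟨rfl, rfl⟩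
    | condFalse hx' _ => exact absurd hx' hx
  | condFalse hx _ ih =>
    intro _ _ h₂
    cases h₂ with
    | condTrue hx' _ => exact absurd hx hx'
    | condFalse _ h => obtain ⟨rfl, rfl⟩ := ih h; exact ⟨rfl, rfl⟩
  | loopStop hx =>
    intro _ _ h₂
    cases h₂ with
    | loopStop _ => exact ⟨rfl, rfl⟩
    | loopStep hx' _ _ => exact absurd hx hx'
  | loopStep hx _ _ ih ih' =>
    intro _ _ h₂
    cases h₂ with
    | loopStop hx' => exact absurd hx' hx
    | loopStep _ h h' => obtain ⟨rfl, rfl⟩ := ih h; obtain ⟨rfl, rfl⟩ := ih' h'; exact ⟨rfl, rfl⟩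
  | _ => intro _ _ h₂; cases h₂; exact ⟨rfl, rfl⟩

/-- On input `w` the program halts after operations of total cost at most `T`, and variable `0`
then holds `1` if `yes` is true and `0` if it is false. -/
def RamProgram.AnswersWithin (P : RamProgram) (w : List ℕ) (yes : Prop) (T : ℕ) : Prop :=
  ∃ t s, RamExec P (RamState.init w) t s ∧ t ≤ T ∧
    (yes → s.var 0 = 1) ∧ (¬ yes → s.var 0 = 0)

/-! Each profile ranks the candidates by decreasing number of votes. Without the diversity
constraint the best committee is simply the top `k`, so deviations are needed only to reach distance
`ℓ` from the two neighbouring committees. An exchange argument confines them to a window around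
position `k`. Suppose that a committee omits a candidate ranked far above position `k` or contains
one ranked far below it. Then at least `2 * ℓ + 3` candidates are available for a swap or an
insertion that moves the committee up the ranking. A change of at most two elements endangers a
distance only if that distance is at most `ℓ + 1`, and then it is harmless as soon as one changed
element lies outside that symmetric difference. The two neighbours thus forbid at most `2 * ℓ + 2`
choices, so a safe one remains (`exists_good_mem`, `exists_improvement`). A feasible sequence that
maximizes a rank potential therefore stays inside the window in all profiles at once
(`exists_feasible_near_top`).

A committee inside the window is described by `8 * ℓ + 12` bits, one for each rank in the window
(`exists_mask`). Dynamic programming over pairs of a profile and a mask decides which committees end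
a feasible sequence (`Reachable`, `tableEntry_eq`). This takes `2 ^ O(ℓ)` times polynomial time.

The same program settles the parameter `k`: two committees of size at most `k` differ in at most `2
* k` candidates, so `ℓ` may be replaced by its minimum with `2 * k + 1` (`diffBound_le_iff`).

For the cost on the machine, expressions are compiled compositionally. `Den` bounds value and cost
by a power of one number `Q`, proportional to the number of masks times the input size, so only
exponents have to be tracked. -/

/-! ### Exchanges in committees and their effect on distances. -/

/-- If `D` has at least `ℓ + 2` elements, toggling two of them cannot hurt. Otherwise toggling `q`
gains one element, which pays for the one that `p` may cost. Here `D` plays the distance set of a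
committee and its neighbour. -/
theorem le_card_symmDiff_pair {α : Type*} [DecidableEq α] {D : Finset α} {p q : α} {ℓ : ℕ}
    (h : ℓ ≤ D.card) (hpq : p ≠ q) (hq : q ∉ if D.card ≤ ℓ + 1 then D else ∅) :
    ℓ ≤ (symmDiff D {p, q}).card := by
  split_ifs at hq with hD
  · have hsub : insert q (D.erase p) ⊆ symmDiff D {p, q} := by
      intro c hc
      simp only [Finset.mem_insert, Finset.mem_erase, Finset.mem_symmDiff,
        Finset.mem_singleton] at hc ⊢
      by_cases hcq : c = q
      · subst hcq; exact Or.inr ⟨Or.inr rfl, hq⟩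
      · rcases hc with hc | hc
        · exact absurd hc hcq
        · exact Or.inl ⟨hc.2, by tauto⟩
    have h1 := Finset.card_le_card hsub
    rw [Finset.card_insert_of_notMem (by simp [hq])] at h1
    have h2 := Finset.pred_card_le_card_erase (s := D) (a := p)
    omega
  · have hsub : D \ {p, q} ⊆ symmDiff D {p, q} := by
      intro c hc
      simp only [Finset.mem_sdiff, Finset.mem_symmDiff] at hc ⊢
      exact Or.inl hc
    have h1 := Finset.card_le_card hsub
    have h2 := Finset.le_card_sdiff {p, q} D
    have h3 : ({p, q} : Finset α).card ≤ 2 := Finset.card_le_two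
    omega

theorem le_card_symmDiff_singleton {α : Type*} [DecidableEq α] {D : Finset α} {q : α} {ℓ : ℕ}
    (h : ℓ ≤ D.card) (hq : q ∉ if D.card ≤ ℓ + 1 then D else ∅) :
    ℓ ≤ (symmDiff D {q}).card := by
  split_ifs at hq with hD
  · refine h.trans (Finset.card_le_card fun c hc => ?_)
    simp only [Finset.mem_symmDiff, Finset.mem_singleton]
    exact Or.inl ⟨hc, fun hcq => hq (hcq ▸ hc)⟩
  · have hsub : D \ {q} ⊆ symmDiff D {q} := by
      intro c hc
      simp only [Finset.mem_sdiff, Finset.mem_symmDiff] at hc ⊢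
      exact Or.inl hc
    have h1 := Finset.card_le_card hsub
    have h2 := Finset.le_card_sdiff {q} D
    have h3 : ({q} : Finset α).card = 1 := Finset.card_singleton q
    omega

/-- Among sufficiently many elements there is one whose change keeps both distances large. -/
theorem exists_good_mem {α : Type*} [DecidableEq α] {Q : Finset α} {ℓ : ℕ}
    (hQ : 2 * ℓ + 2 < Q.card) (D E : Finset α) :
    ∃ q ∈ Q, (q ∉ if D.card ≤ ℓ + 1 then D else ∅) ∧ (q ∉ if E.card ≤ ℓ + 1 then E else ∅) := by
  have hb : ∀ D : Finset α, (if D.card ≤ ℓ + 1 then D else ∅).card ≤ ℓ + 1 := by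
    intro D
    split_ifs with h
    · exact h
    · simp
  obtain ⟨q, hq, hq'⟩ := Finset.exists_mem_notMem_of_card_lt_card
    (s := (if D.card ≤ ℓ + 1 then D else ∅) ∪ (if E.card ≤ ℓ + 1 then E else ∅)) (t := Q)
    (lt_of_le_of_lt (Finset.card_union_le _ _) (by have := hb D; have := hb E; omega))
  rw [Finset.mem_union, not_or] at hq'
  exact ⟨q, hq, hq'⟩

theorem symmDiff_pair_of_mem {α : Type*} [DecidableEq α] {S : Finset α} {p q : α}
    (hp : p ∈ S) (hq : q ∉ S) : symmDiff S {p, q} = insert q (S.erase p) := by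
  ext c
  have hpq : p ≠ q := fun h => hq (h ▸ hp)
  simp only [Finset.mem_symmDiff, Finset.mem_insert, Finset.mem_singleton, Finset.mem_erase]
  by_cases h1 : c = p
  · subst h1; simp [hp, hpq]
  · by_cases h2 : c = q
    · subst h2; simp [hq]
    · simp [h1, h2]

theorem symmDiff_singleton_of_notMem {α : Type*} [DecidableEq α] {S : Finset α} {q : α}
    (hq : q ∉ S) : symmDiff S {q} = insert q S := by
  ext c
  simp only [Finset.mem_symmDiff, Finset.mem_insert, Finset.mem_singleton]
  by_cases h2 : c = q
  · subst h2; simp [hq]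
  · simp [h2]

theorem sum_symmDiff_pair {α : Type*} [DecidableEq α] {S : Finset α} {p q : α}
    (hp : p ∈ S) (hq : q ∉ S) (f : α → ℕ) :
    ∑ c ∈ symmDiff S {p, q}, f c + f p = ∑ c ∈ S, f c + f q := by
  rw [symmDiff_pair_of_mem hp hq, Finset.sum_insert (by simp [hq])]
  have := Finset.sum_erase_add S f hp
  omega

/-- A committee that deviates from the `k` best candidates far away from the `k`-th position can be
replaced by one with higher-ranked members. -/
theorem exists_improvement {n k ℓ : ℕ} {rank wt : Fin n → ℕ} (hlt : ∀ c, rank c < n)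
    (hcount : ∀ j ≤ n, (Finset.univ.filter fun c => rank c < j).card = j)
    (hwt : ∀ p q, rank p < rank q → wt q ≤ wt p) (hk : k ≤ n) {S : Finset (Fin n)}
    (hS : S.card ≤ k)
    (hbad : ∃ p, (p ∉ S ∧ rank p + (4 * ℓ + 6) < k) ∨ (p ∈ S ∧ k + (4 * ℓ + 6) ≤ rank p))
    (L R : Finset (Fin n)) :
    ∃ S' : Finset (Fin n), S'.card ≤ k ∧ ∑ c ∈ S, wt c ≤ ∑ c ∈ S', wt c ∧
      ∑ c ∈ S, (n - rank c) < ∑ c ∈ S', (n - rank c) ∧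
      (ℓ ≤ (symmDiff S L).card → ℓ ≤ (symmDiff S' L).card) ∧
      (ℓ ≤ (symmDiff S R).card → ℓ ≤ (symmDiff S' R).card) := by
  have hcomm : ∀ T L : Finset (Fin n), symmDiff (symmDiff S T) L = symmDiff (symmDiff S L) T :=
    fun T L => symmDiff_right_comm S T L
  -- exchanging `p ∈ S` for a better `q ∉ S`
  have swap : ∀ p q b, p ∈ S → q ∉ S → (b = p ∨ b = q) → rank q < rank p →
      (b ∉ if (symmDiff S L).card ≤ ℓ + 1 then symmDiff S L else ∅) →
      (b ∉ if (symmDiff S R).card ≤ ℓ + 1 then symmDiff S R else ∅) →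
      ∃ S' : Finset (Fin n), S'.card ≤ k ∧ ∑ c ∈ S, wt c ≤ ∑ c ∈ S', wt c ∧
        ∑ c ∈ S, (n - rank c) < ∑ c ∈ S', (n - rank c) ∧
        (ℓ ≤ (symmDiff S L).card → ℓ ≤ (symmDiff S' L).card) ∧
        (ℓ ≤ (symmDiff S R).card → ℓ ≤ (symmDiff S' R).card) := by
    intro p q b hp hq hb hr hL hR
    have hpq : p ≠ q := fun h => hq (h ▸ hp)
    -- The safe element `b` may be the one that leaves or the one that enters, since the toggled
    -- pair is unordered.
    have key : ∀ D : Finset (Fin n), ℓ ≤ D.card →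
        (b ∉ if D.card ≤ ℓ + 1 then D else ∅) → ℓ ≤ (symmDiff D {p, q}).card := by
      intro D hD hbD
      rcases hb with rfl | rfl
      · rw [Finset.pair_comm]; exact le_card_symmDiff_pair hD hpq.symm hbD
      · exact le_card_symmDiff_pair hD hpq hbD
    refine ⟨symmDiff S {p, q}, ?_, ?_, ?_, ?_, ?_⟩
    · rw [symmDiff_pair_of_mem hp hq, Finset.card_insert_of_notMem (by simp [hq]),
        Finset.card_erase_add_one hp]
      exact hS
    · have := sum_symmDiff_pair hp hq wt
      have := hwt q p hr
      omega
    · have := sum_symmDiff_pair hp hq (fun c => n - rank c)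
      have := hlt p
      omega
    · intro h; rw [hcomm]; exact key _ h hL
    · intro h; rw [hcomm]; exact key _ h hR
  obtain ⟨p, ⟨hpS, hp⟩ | ⟨hpS, hp⟩⟩ := hbad
  -- If there is room and many of the top `k` are missing, one of them can be inserted without
  -- removing anybody.
  · by_cases hadd : S.card < k ∧
        2 * ℓ + 2 < ((Finset.univ.filter fun c => rank c < k) \ S).card
    · obtain ⟨q, hq, hL, hR⟩ := exists_good_mem hadd.2 (symmDiff S L) (symmDiff S R)
      simp only [Finset.mem_sdiff, Finset.mem_filter, Finset.mem_univ, true_and] at hq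
      refine ⟨symmDiff S {q}, ?_, ?_, ?_, ?_, ?_⟩
      · rw [symmDiff_singleton_of_notMem hq.2, Finset.card_insert_of_notMem hq.2]; exact hadd.1
      · rw [symmDiff_singleton_of_notMem hq.2, Finset.sum_insert hq.2]; omega
      · rw [symmDiff_singleton_of_notMem hq.2, Finset.sum_insert hq.2]
        have := hlt q
        omega
      · intro h; rw [hcomm]; exact le_card_symmDiff_singleton h hL
      · intro h; rw [hcomm]; exact le_card_symmDiff_singleton h hR
    -- Otherwise `S` is full or misses at most `2 * ℓ + 2` of the top `k`. As `A` has only `k - (4 *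
    -- ℓ + 6)` elements, at least `2 * ℓ + 4` members of `S` lie outside `A`. All of these rank
    -- below `p`, so a safe one can be exchanged for `p`.
    · have hcard : 2 * ℓ + 2 < (S \ (Finset.univ.filter fun c => rank c < k - (4 * ℓ + 6))).card := by
        set A := Finset.univ.filter fun c => rank c < k - (4 * ℓ + 6) with hA
        have hAc : A.card = k - (4 * ℓ + 6) := hcount _ (by omega)
        by_cases hSk : S.card < k
        · have h1 : ((Finset.univ.filter fun c => rank c < k) \ S).card ≤ 2 * ℓ + 2 := by
            by_contra hcon
            exact hadd ⟨hSk, by omega⟩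
          have h2 : (Finset.univ.filter fun c => rank c < k) ⊆
              ((Finset.univ.filter fun c => rank c < k) \ S) ∪ ((S \ A) ∪ A.erase p) := by
            intro c hc
            have : c = p → c ∉ S := fun h => h ▸ hpS
            simp only [Finset.mem_union, Finset.mem_sdiff, Finset.mem_erase]
            tauto
          have h3 := Finset.card_le_card h2
          have h4 := Finset.card_union_le ((Finset.univ.filter fun c => rank c < k) \ S)
            ((S \ A) ∪ A.erase p)
          have h5 := Finset.card_union_le (S \ A) (A.erase p)
          have h6 := Finset.card_erase_le (s := A) (a := p)
          rw [hcount k hk] at h3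
          omega
        · have h2 : S ⊆ (S \ A) ∪ A.erase p := by
            intro c hc
            have : c = p → c ∉ S := fun h => h ▸ hpS
            simp only [Finset.mem_union, Finset.mem_sdiff, Finset.mem_erase]
            tauto
          have h3 := Finset.card_le_card h2
          have h5 := Finset.card_union_le (S \ A) (A.erase p)
          have h6 := Finset.card_erase_le (s := A) (a := p)
          omega
      obtain ⟨q, hq, hL, hR⟩ := exists_good_mem hcard (symmDiff S L) (symmDiff S R)
      simp only [Finset.mem_sdiff, Finset.mem_filter, Finset.mem_univ, true_and] at hq
      exact swap q p q hq.1 hpS (Or.inl rfl) (by omega) hL hR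
  -- Among the first `k + (4 * ℓ + 6)` candidates at most `k` belong to `S`, so at least `4 * ℓ + 6`
  -- better replacements for `p` are available.
  · have hcard : 2 * ℓ + 2 <
        ((Finset.univ.filter fun c => rank c < k + (4 * ℓ + 6)) \ S).card := by
      have h1 := Finset.le_card_sdiff S (Finset.univ.filter fun c => rank c < k + (4 * ℓ + 6))
      rw [hcount _ (by have := hlt p; omega)] at h1
      omega
    obtain ⟨q, hq, hL, hR⟩ := exists_good_mem hcard (symmDiff S L) (symmDiff S R)
    simp only [Finset.mem_sdiff, Finset.mem_filter, Finset.mem_univ, true_and] at hq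
    exact swap p q q hpS hq.2 (Or.inr rfl) (by omega) hL hR

/-- Feasible sequences can be assumed to deviate from the best candidates only near the `k`-th
position. -/
theorem exists_feasible_near_top {τ n k x ℓ : ℕ} {rank wt : Fin τ → Fin n → ℕ}
    (hlt : ∀ i c, rank i c < n)
    (hcount : ∀ i, ∀ j ≤ n, (Finset.univ.filter fun c => rank i c < j).card = j)
    (hwt : ∀ i p q, rank i p < rank i q → wt i q ≤ wt i p) (hk : k ≤ n)
    (h : ∃ S : Fin τ → Finset (Fin n), (∀ i, (S i).card ≤ k ∧ x ≤ ∑ c ∈ S i, wt i c) ∧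
      ∀ i j : Fin τ, (j : ℕ) = (i : ℕ) + 1 → ℓ ≤ (symmDiff (S i) (S j)).card) :
    ∃ S : Fin τ → Finset (Fin n), ((∀ i, (S i).card ≤ k ∧ x ≤ ∑ c ∈ S i, wt i c) ∧
      ∀ i j : Fin τ, (j : ℕ) = (i : ℕ) + 1 → ℓ ≤ (symmDiff (S i) (S j)).card) ∧
      ∀ i c, (rank i c + (4 * ℓ + 6) < k → c ∈ S i) ∧
        (c ∈ S i → rank i c < k + (4 * ℓ + 6)) := by
  classical
  set F : Finset (Fin τ → Finset (Fin n)) := Finset.univ.filter fun S =>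
    (∀ i, (S i).card ≤ k ∧ x ≤ ∑ c ∈ S i, wt i c) ∧
      ∀ i j : Fin τ, (j : ℕ) = (i : ℕ) + 1 → ℓ ≤ (symmDiff (S i) (S j)).card with hF
  obtain ⟨S₀, hS₀⟩ := h
  -- Improving one committee can change what is safe for its neighbours; maximizing a potential
  -- summed over all profiles avoids any question of order or termination.
  obtain ⟨S, hSF, hmax⟩ := F.exists_max_image
    (fun S => ∑ i, ∑ c ∈ S i, (n - rank i c)) ⟨S₀, by simpa [hF] using hS₀⟩
  have hS := (Finset.mem_filter.1 hSF).2
  refine ⟨S, hS, ?_⟩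
  by_contra hcon
  push Not at hcon
  obtain ⟨i, p, hp⟩ := hcon
  -- At the ends of the sequence the missing neighbour is replaced by `∅`; the distance statement
  -- for it is never used.
  obtain ⟨S', h1, h2, h3, h4, h5⟩ := exists_improvement (ℓ := ℓ) (hlt i) (hcount i) (hwt i) hk
    (hS.1 i).1 ⟨p, by
      by_cases h : rank i p + (4 * ℓ + 6) < k ∧ p ∉ S i
      · exact Or.inl ⟨h.2, h.1⟩
      · exact Or.inr (hp fun h' => by tauto)⟩
    (if h : 0 < (i : ℕ) then S ⟨i - 1, by omega⟩ else ∅)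
    (if h : (i : ℕ) + 1 < τ then S ⟨i + 1, h⟩ else ∅)
  have hmem : Function.update S i S' ∈ F := by
    refine Finset.mem_filter.2 ⟨Finset.mem_univ _, fun j => ?_, fun j j' hj => ?_⟩
    · by_cases hji : j = i
      · subst hji
        simp only [Function.update_self]
        exact ⟨h1, (hS.1 j).2.trans h2⟩
      · simp only [Function.update_of_ne hji]
        exact hS.1 j
    · by_cases hji : j = i
      · subst hji
        have hne : j' ≠ j := by intro h; rw [h] at hj; omega
        have hτ : (j : ℕ) + 1 < τ := hj ▸ j'.2
        have hj' : j' = ⟨j + 1, hτ⟩ := Fin.ext hj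
        simp only [Function.update_self, Function.update_of_ne hne]
        rw [dif_pos hτ, ← hj'] at h5
        exact h5 (hS.2 j j' hj)
      · by_cases hji' : j' = i
        · subst hji'
          have hpos : 0 < (j' : ℕ) := by omega
          have hj' : j = ⟨(j' : ℕ) - 1, by omega⟩ := Fin.ext (by simp only; omega)
          simp only [Function.update_self, Function.update_of_ne hji]
          rw [dif_pos hpos, ← hj'] at h4
          rw [symmDiff_comm]
          exact h4 (by rw [symmDiff_comm]; exact hS.2 j j' hj)
        · simp only [Function.update_of_ne hji, Function.update_of_ne hji']
          exact hS.2 j j' hj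
  refine absurd (hmax _ hmem) (not_le.2 ?_)
  refine Finset.sum_lt_sum (fun j _ => ?_) ⟨i, Finset.mem_univ _, ?_⟩
  · by_cases hji : j = i
    · subst hji; simpa only [Function.update_self] using h3.le
    · simp only [Function.update_of_ne hji]; exact le_rfl
  · simpa only [Function.update_self] using h3

/-! ### Expressions -/

/-- An expression, given by programs: `e d` computes the value of the expression into variable `d`
and leaves all variables below `d` unchanged. -/
abbrev RamExp := ℕ → RamProgram

/-- `s'` agrees with `s` in all arrays and in all variables below `d ≤ d'`. -/
structure RamState.Extends (s : RamState) (d : ℕ) (s' : RamState) (d' : ℕ) : Prop where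
  le : d ≤ d'
  var : ∀ x < d, s'.var x = s.var x
  arr : s'.arr = s.arr

theorem RamState.Extends.trans {s s₁ s₂ : RamState} {d d₁ d₂ : ℕ} (h : s.Extends d s₁ d₁)
    (h' : s₁.Extends d₁ s₂ d₂) : s.Extends d s₂ d₂ :=
  ⟨h.le.trans h'.le, fun x hx => (h'.var x (hx.trans_le h.le)).trans (h.var x hx),
    h'.arr.trans h.arr⟩

namespace RamExp

/-- In every state that extends `s` above `d`, the expression `e` has the value `v`, and `Q ^ a`
bounds this value as well as the cost of the evaluation. -/
def Den (Q : ℕ) (s : RamState) (d : ℕ) (e : RamExp) (v a : ℕ) : Prop :=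
  v ≤ Q ^ a ∧ ∀ s' d', s.Extends d s' d' → ∃ t s'', RamExec (e d') s' t s'' ∧ t ≤ Q ^ a ∧
    s''.var d' = v ∧ s'.Extends d' s'' d'

variable {Q : ℕ} {s s₁ : RamState} {d d₁ : ℕ} {e f : RamExp} {v w a b : ℕ}

/-- Arguments of a compound expression are themselves programs, run later when more variables are
occupied; this is what lets them be used inside loop bodies. -/
theorem Den.mono (h : Den Q s d e v a) (hs : s.Extends d s₁ d₁) : Den Q s₁ d₁ e v a :=
  ⟨h.1, fun s' d' h' => h.2 s' d' (hs.trans h')⟩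

theorem Den.weaken [Fact (32 ≤ Q)] (h : Den Q s d e v a) (hab : a ≤ b) : Den Q s d e v b := by
  have hQ : 32 ≤ Q := Fact.out
  have hp : Q ^ a ≤ Q ^ b := Nat.pow_le_pow_right (by omega) hab
  refine ⟨h.1.trans hp, fun s' d' h' => ?_⟩
  obtain ⟨t, s'', h1, h2, h3⟩ := h.2 s' d' h'
  exact ⟨t, s'', h1, h2.trans hp, h3⟩

theorem Den.congr (h : Den Q s d e v a) (hv : v = w) : Den Q s d e w a := hv ▸ h

theorem size_le_self (n : ℕ) : n.size ≤ n := Nat.size_le.2 Nat.lt_two_pow_self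

theorem extends_setVar (s : RamState) (d n : ℕ) : s.Extends d (s.setVar d n) d :=
  ⟨le_rfl, fun x hx => by simp [RamState.setVar, hx.ne], rfl⟩

theorem extends_setVar_of_le (s : RamState) {d x : ℕ} (hx : d ≤ x) (n : ℕ) :
    s.Extends d (s.setVar x n) d :=
  ⟨le_rfl, fun y hy => by simp [RamState.setVar, (hy.trans_le hx).ne], rfl⟩

theorem extends_refl (s : RamState) (d : ℕ) : s.Extends d s d := ⟨le_rfl, fun _ _ => rfl, rfl⟩

theorem extends_add (s : RamState) (d k : ℕ) : s.Extends d s (d + k) :=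
  ⟨by omega, fun _ _ => rfl, rfl⟩

theorem extends_restrict {s s' : RamState} {d d' : ℕ} (h : s.Extends d' s' d') (hd : d ≤ d') :
    s.Extends d s' d := ⟨le_rfl, fun x hx => h.var x (hx.trans_le hd), h.arr⟩

/-- The constant `n`. -/
def const (n : ℕ) : RamExp := fun d => .const d n

theorem Den.const [Fact (32 ≤ Q)] (n : ℕ) (hn : n ≤ 16 := by norm_num) :
    Den Q s d (RamExp.const n) n 1 := by
  have hQ : 32 ≤ Q := Fact.out
  refine ⟨by rw [pow_one]; omega, fun s' d' h' => ⟨_, _, RamExec.const s' d' n, ?_, ?_, ?_⟩⟩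
  · have := size_le_self n
    rw [pow_one]; omega
  · simp [RamState.setVar]
  · exact extends_setVar _ _ _

/-- The value of variable `x`. -/
def var (x : ℕ) : RamExp := fun d => .copy d x

theorem Den.var [Fact (32 ≤ Q)] {x : ℕ} (hx : x < d) (hv : s.var x = v) (hva : v ≤ Q ^ a) :
    Den Q s d (RamExp.var x) v (a + 1) := by
  have hQ : 32 ≤ Q := Fact.out
  have hp : 1 ≤ Q ^ a := Nat.one_le_pow _ _ (by omega)
  have hp' : 32 * Q ^ a ≤ Q ^ (a + 1) := by rw [pow_succ, mul_comm]; gcongr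
  refine ⟨by omega, fun s' d' h' => ⟨_, _, RamExec.copy s' d' x, ?_, ?_, ?_⟩⟩
  · rw [h'.var x hx, hv]
    have := size_le_self v
    omega
  · simp [RamState.setVar, h'.var x hx, hv]
  · exact extends_setVar _ _ _

/-- These linear relations between powers are all that the cost estimates need: a factor `32`
absorbs the constantly many elementary operations of one construct, at the price of one more in the
exponent. -/
theorem pow_max_bound {Q : ℕ} (hQ : 32 ≤ Q) (a b : ℕ) :
    1 ≤ Q ^ max a b ∧ Q ^ a ≤ Q ^ max a b ∧ Q ^ b ≤ Q ^ max a b ∧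
      32 * Q ^ max a b ≤ Q ^ (max a b + 1) ∧ 32 * Q ^ (max a b + 1) ≤ Q ^ (max a b + 2) := by
  refine ⟨Nat.one_le_pow _ _ (by omega), Nat.pow_le_pow_right (by omega) (le_max_left _ _),
    Nat.pow_le_pow_right (by omega) (le_max_right _ _), ?_, ?_⟩
  · rw [pow_succ, mul_comm]; gcongr
  · rw [pow_succ _ (max a b + 1), mul_comm]; gcongr

/-- Evaluation of two expressions into consecutive variables. -/
theorem Den.pair (he : Den Q s d e v a) (hf : Den Q s d f w b) {s' : RamState} {d' : ℕ}
    (h : s.Extends d s' d') : ∃ t s'', RamExec (.seq (e d') (f (d' + 1))) s' t s'' ∧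
      t ≤ Q ^ a + Q ^ b ∧ s''.var d' = v ∧ s''.var (d' + 1) = w ∧ s'.Extends d' s'' d' := by
  obtain ⟨t₁, s₁, h1, h2, h3, h4⟩ := he.2 s' d' h
  obtain ⟨t₂, s₂, h5, h6, h7, h8⟩ := hf.2 s₁ (d' + 1) ((h.trans h4).trans (extends_add _ _ _))
  exact ⟨_, _, h1.seq h5, by omega, by rw [h8.var _ (by omega), h3], h7,
    h4.trans (extends_restrict h8 (by omega))⟩

/-- The sum. -/
def add (e f : RamExp) : RamExp := fun d => .seq (.seq (e d) (f (d + 1))) (.add d d (d + 1))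

theorem Den.add [Fact (32 ≤ Q)] (he : Den Q s d e v a) (hf : Den Q s d f w b) :
    Den Q s d (RamExp.add e f) (v + w) (max a b + 1) := by
  have hQ : 32 ≤ Q := Fact.out
  obtain ⟨p1, p2, p3, p4, -⟩ := pow_max_bound hQ a b
  have := he.1
  have := hf.1
  refine ⟨by omega, fun s' d' h => ?_⟩
  obtain ⟨t, s₂, h1, h2, h3, h4, h5⟩ := he.pair hf h
  refine ⟨_, _, h1.seq (RamExec.add s₂ d' d' (d' + 1)), ?_, ?_, h5.trans (extends_setVar _ _ _)⟩
  · rw [h3, h4]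
    have := size_le_self v
    have := size_le_self w
    omega
  · simp [RamState.setVar, h3, h4]

/-- The truncated difference. -/
def sub (e f : RamExp) : RamExp := fun d => .seq (.seq (e d) (f (d + 1))) (.sub d d (d + 1))

theorem Den.sub [Fact (32 ≤ Q)] (he : Den Q s d e v a) (hf : Den Q s d f w b) :
    Den Q s d (RamExp.sub e f) (v - w) (max a b + 1) := by
  have hQ : 32 ≤ Q := Fact.out
  obtain ⟨p1, p2, p3, p4, -⟩ := pow_max_bound hQ a b
  have := he.1
  have := hf.1
  refine ⟨by omega, fun s' d' h => ?_⟩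
  obtain ⟨t, s₂, h1, h2, h3, h4, h5⟩ := he.pair hf h
  refine ⟨_, _, h1.seq (RamExec.sub s₂ d' d' (d' + 1)), ?_, ?_, h5.trans (extends_setVar _ _ _)⟩
  · rw [h3, h4]
    have := size_le_self v
    have := size_le_self w
    omega
  · simp [RamState.setVar, h3, h4]

/-- The entry of array `A` at the given address. -/
def get (A : ℕ) (e : RamExp) : RamExp := fun d => .seq (e d) (.load d A d)

theorem Den.get [Fact (32 ≤ Q)] {A : ℕ} (he : Den Q s d e v a) (hw : s.arr A v = w)
    (hwb : w ≤ Q ^ b) : Den Q s d (RamExp.get A e) w (max a b + 1) := by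
  have hQ : 32 ≤ Q := Fact.out
  obtain ⟨p1, p2, p3, p4, -⟩ := pow_max_bound hQ a b
  have := he.1
  refine ⟨by omega, fun s' d' h => ?_⟩
  obtain ⟨t, s₂, h1, h2, h3, h4⟩ := he.2 s' d' h
  have harr : s₂.arr A v = w := by rw [h4.arr, h.arr, hw]
  refine ⟨_, _, h1.seq (RamExec.load s₂ d' A d'), ?_, ?_, h4.trans (extends_setVar _ _ _)⟩
  · rw [h3, harr]
    have := size_le_self v
    have := size_le_self w
    omega
  · simp [RamState.setVar, h3, harr]

/-- The minimum of an array entry and of the value of `f`. -/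
def getMin (A : ℕ) (e f : RamExp) : RamExp := fun d =>
  .seq (.seq (.seq (e d) (f (d + 1))) (.load d A d))
    (.seq (.sub (d + 1) d (d + 1)) (.sub d d (d + 1)))

/-- The entry `u` may be exponentially large in the input size, so only its bit length is assumed
bounded. The formula `u - (u - w)` gives the minimum without a loop, and after this step every value
is small. -/
theorem Den.getMin [Fact (32 ≤ Q)] {A u : ℕ} (he : Den Q s d e v a) (hf : Den Q s d f w b)
    (hu : s.arr A v = u) (hsize : u.size ≤ Q) :
    Den Q s d (RamExp.getMin A e f) (min u w) (max a b + 2) := by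
  have hQ : 32 ≤ Q := Fact.out
  obtain ⟨p1, p2, p3, p4, p5⟩ := pow_max_bound hQ a b
  have := he.1
  have := hf.1
  have p6 : Q ≤ Q ^ (max a b + 1) := by
    rw [pow_succ]; exact Nat.le_mul_of_pos_left _ p1
  refine ⟨by omega, fun s' d' h => ?_⟩
  obtain ⟨t, s₂, h1, h2, h3, h4, h5⟩ := he.pair hf h
  have harr : s₂.arr A v = u := by rw [h5.arr, h.arr, hu]
  refine ⟨_, _, (h1.seq (RamExec.load s₂ d' A d')).seq
    ((RamExec.sub _ (d' + 1) d' (d' + 1)).seq (RamExec.sub _ d' d' (d' + 1))), ?_, ?_, ?_⟩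
  · have := size_le_self v
    have := size_le_self w
    have : (u - w).size ≤ u.size := Nat.size_le_size (Nat.sub_le _ _)
    simp [RamState.setVar, h3, h4, harr]
    omega
  · simp [RamState.setVar, h3, h4, harr]
    omega
  · refine ((h5.trans (extends_setVar _ _ _)).trans (extends_setVar_of_le _ ?_ _)).trans
      (extends_setVar _ _ _)
    omega

/-- `f` if the value of `c` is nonzero, and `g` otherwise. -/
def ite (c f g : RamExp) : RamExp := fun d => .seq (c d) (.cond d (f d) (g d))

theorem Den.ite [Fact (32 ≤ Q)] {c g : RamExp} {u : ℕ} (hc : Den Q s d c u a)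
    (hf : u ≠ 0 → Den Q s d f v b) (hg : u = 0 → Den Q s d g w b) :
    Den Q s d (RamExp.ite c f g) (if u = 0 then w else v) (max a b + 1) := by
  have hQ : 32 ≤ Q := Fact.out
  obtain ⟨p1, p2, p3, p4, -⟩ := pow_max_bound hQ a b
  have := hc.1
  have hsz := size_le_self u
  split_ifs with hu
  · have := (hg hu).1
    refine ⟨by omega, fun s' d' h => ?_⟩
    obtain ⟨t, s₁, h1, h2, h3, h4⟩ := hc.2 s' d' h
    obtain ⟨t', s₂, h5, h6, h7, h8⟩ := (hg hu).2 s₁ d' (h.trans h4)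
    refine ⟨_, _, h1.seq (RamExec.condFalse (by rw [h3, hu]) h5), ?_, h7, h4.trans h8⟩
    rw [h3]
    omega
  · have := (hf hu).1
    refine ⟨by omega, fun s' d' h => ?_⟩
    obtain ⟨t, s₁, h1, h2, h3, h4⟩ := hc.2 s' d' h
    obtain ⟨t', s₂, h5, h6, h7, h8⟩ := (hf hu).2 s₁ d' (h.trans h4)
    refine ⟨_, _, h1.seq (RamExec.condTrue (by rw [h3]; exact hu) h5), ?_, h7, h4.trans h8⟩
    rw [h3]
    omega

/-- Starting from `e`, the values of `n` applications of `f`; its arguments are the index of the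
iteration and the previous value. -/
def fold (n e : RamExp) (f : RamExp → RamExp → RamExp) : RamExp := fun d =>
  .seq (.seq (.seq (.seq (n d) (e (d + 1))) (.const (d + 2) 0)) (.const (d + 3) 1))
    (.seq (.loop d (.seq (.seq (f (var (d + 2)) (var (d + 1)) (d + 4)) (.copy (d + 1) (d + 4)))
      (.seq (.add (d + 2) (d + 2) (d + 3)) (.sub d d (d + 3))))) (.copy d (d + 1)))

/-- The loop runs `N ≤ Q` times, which costs one factor `Q`. Index and accumulator reach the body as
variables, and reading a variable raises the exponent by one; hence `2` for the index, bounded by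
`Q`, and `b + 1` for the accumulator. The body's exponent `c` must not depend on the iteration, so
`hg` bounds all intermediate values beforehand. -/
theorem Den.fold [Fact (32 ≤ Q)] {n : RamExp} {f : RamExp → RamExp → RamExp} {N c : ℕ}
    {g : ℕ → ℕ} (hn : Den Q s d n N a) (he : Den Q s d e (g 0) b)
    (hf : ∀ i < N, ∀ s₁ d₁, s.Extends d s₁ d₁ → ∀ X Y, Den Q s₁ d₁ X i 2 →
      Den Q s₁ d₁ Y (g i) (b + 1) → Den Q s₁ d₁ (f X Y) (g (i + 1)) c)
    (hN : N ≤ Q) (hg : ∀ i ≤ N, g i ≤ Q ^ b) :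
    Den Q s d (RamExp.fold n e f) (g N) (max (max a b) c + 3) := by
  have hQ : 32 ≤ Q := Fact.out
  set m := max (max a b) c with hm
  obtain ⟨p1, p2, p3, p4, p5⟩ := pow_max_bound hQ (max a b) c
  obtain ⟨-, q2, q3, -, -⟩ := pow_max_bound hQ a b
  rw [← hm] at p1 p2 p3 p4 p5
  have p6 : 32 * Q ^ (m + 2) ≤ Q ^ (m + 3) := by
    rw [pow_succ _ (m + 2), mul_comm]; gcongr
  have p7 : Q ≤ Q ^ (m + 1) := by rw [pow_succ]; exact Nat.le_mul_of_pos_left _ p1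
  have hgN := hg N le_rfl
  refine ⟨by omega, fun s' d' h => ?_⟩
  -- Variable `d'` counts the remaining iterations, `d' + 1` holds the accumulator, `d' + 2` the
  -- index and `d' + 3` the constant one; the body works from `d' + 4` on.
  have loop : ∀ r ≤ N, ∀ s₁ : RamState, s.Extends d s₁ d' → s₁.var d' = r →
      s₁.var (d' + 1) = g (N - r) → s₁.var (d' + 2) = N - r → s₁.var (d' + 3) = 1 →
      ∃ t s₂, RamExec (.loop d' (.seq (.seq (f (RamExp.var (d' + 2)) (RamExp.var (d' + 1)) (d' + 4))
        (.copy (d' + 1) (d' + 4)))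
        (.seq (.add (d' + 2) (d' + 2) (d' + 3)) (.sub d' d' (d' + 3))))) s₁ t s₂ ∧
        t ≤ r * (5 * Q ^ (m + 1)) + 1 ∧ s₂.var (d' + 1) = g N ∧ s₁.Extends d' s₂ d' := by
    intro r
    induction r with
    | zero =>
      intro _ s₁ hs h0 h1 h2 h3
      exact ⟨_, _, RamExec.loopStop h0, by simp [h0], by simpa using h1, extends_refl _ _⟩
    | succ r ih =>
      intro hr s₁ hs h0 h1 h2 h3
      have hi : N - (r + 1) < N := by omega
      have hext : s.Extends d s₁ (d' + 4) := hs.trans (extends_add _ _ _)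
      have hX : Den Q s₁ (d' + 4) (RamExp.var (d' + 2)) (N - (r + 1)) 2 :=
        Den.var (by omega) h2 (by rw [pow_one]; omega)
      have hY : Den Q s₁ (d' + 4) (RamExp.var (d' + 1)) (g (N - (r + 1))) (b + 1) :=
        Den.var (by omega) h1 (hg _ hi.le)
      obtain ⟨t, s₂, e1, e2, e3, e4⟩ := (hf _ hi s₁ (d' + 4) hext _ _ hX hY).2 s₁ (d' + 4)
        (extends_refl _ _)
      have hir : N - (r + 1) + 1 = N - r := by omega
      have v0 : s₂.var d' = r + 1 := by rw [e4.var _ (by omega), h0]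
      have v2 : s₂.var (d' + 2) = N - (r + 1) := by rw [e4.var _ (by omega), h2]
      have v3 : s₂.var (d' + 3) = 1 := by rw [e4.var _ (by omega), h3]
      rw [hir] at e3
      obtain ⟨s₃, hs₃⟩ : ∃ s₃, s₃ = ((s₂.setVar (d' + 1) (g (N - r))).setVar (d' + 2)
        (N - r)).setVar d' r := ⟨_, rfl⟩
      have hx : s₁.Extends d' s₃ d' := by
        rw [hs₃]
        exact (((extends_restrict e4 (by omega)).trans
          (extends_setVar_of_le _ (by omega) _)).trans
          (extends_setVar_of_le _ (by omega) _)).trans (extends_setVar _ _ _)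
      obtain ⟨t', s₄, l1, l2, l3, l4⟩ := ih (by omega) s₃ (hs.trans hx)
        (by simp [hs₃, RamState.setVar]) (by simp [hs₃, RamState.setVar])
        (by simp [hs₃, RamState.setVar]) (by simp [hs₃, RamState.setVar, v3])
      have hbody := (e1.seq (RamExec.copy s₂ (d' + 1) (d' + 4))).seq
        ((RamExec.add _ (d' + 2) (d' + 2) (d' + 3)).seq (RamExec.sub _ d' d' (d' + 3)))
      simp [RamState.setVar, v0, v2, v3, e3, hir] at hbody
      simp only [hs₃, RamState.setVar] at l1
      refine ⟨_, _, RamExec.loopStep (by omega) hbody l1, ?_, l3, hx.trans l4⟩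
      rw [h0]
      have := size_le_self (g (N - r))
      have := hg (N - r) (by omega)
      have := size_le_self (N - (r + 1))
      have := size_le_self (r + 1)
      rw [Nat.succ_mul]
      omega
  obtain ⟨t, s₁, h1, h2, h3, h4, h5⟩ := hn.pair he h
  obtain ⟨s₂, hs₂⟩ : ∃ s₂, s₂ = (s₁.setVar (d' + 2) 0).setVar (d' + 3) 1 := ⟨_, rfl⟩
  have hx : s'.Extends d' s₂ d' := by
    rw [hs₂]
    exact (h5.trans (extends_setVar_of_le _ (by omega) _)).trans
      (extends_setVar_of_le _ (by omega) _)
  obtain ⟨t', s₃, l1, l2, l3, l4⟩ := loop N le_rfl s₂ (h.trans hx)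
    (by simp [hs₂, RamState.setVar, h3]) (by simp [hs₂, RamState.setVar, h4])
    (by simp [hs₂, RamState.setVar]) (by simp [hs₂, RamState.setVar])
  have hinit := (h1.seq (RamExec.const s₁ (d' + 2) 0)).seq (RamExec.const _ (d' + 3) 1)
  rw [hs₂] at l1
  refine ⟨_, _, hinit.seq (l1.seq (RamExec.copy s₃ d' (d' + 1))), ?_, ?_,
    (hx.trans l4).trans (extends_setVar _ _ _)⟩
  · rw [l3]
    have := size_le_self (g N)
    have hmul : N * (5 * Q ^ (m + 1)) ≤ 5 * Q ^ (m + 2) := by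
      calc N * (5 * Q ^ (m + 1)) ≤ Q * (5 * Q ^ (m + 1)) := by gcongr
        _ = 5 * Q ^ (m + 2) := by ring
    simp
    omega
  · simp [RamState.setVar, l3]

end RamExp

/-! ### Derived operations: comparison, summation, multiplication, division, binary digits. -/

namespace RamExp

section

variable {Q : ℕ} [Fact (32 ≤ Q)] {s : RamState} {d : ℕ} {e f : RamExp} {v w a b : ℕ}

/-- The truth value of `e < f`. -/
def lt (e f : RamExp) : RamExp := sub (const 1) (sub (const 1) (sub f e))

theorem Den.lt (he : Den Q s d e v a) (hf : Den Q s d f w b) :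
    Den Q s d (RamExp.lt e f) (if v < w then 1 else 0) (max a b + 4) :=
  (((Den.const _).sub ((Den.const _).sub (hf.sub he))).weaken (by omega)).congr (by split_ifs <;> omega)

/-- The truth value of `e ≤ f`. -/
def le (e f : RamExp) : RamExp := sub (const 1) (sub e f)

theorem Den.le (he : Den Q s d e v a) (hf : Den Q s d f w b) :
    Den Q s d (RamExp.le e f) (if v ≤ w then 1 else 0) (max a b + 3) :=
  (((Den.const _).sub (he.sub hf)).weaken (by omega)).congr (by split_ifs <;> omega)

/-- The distance of the values of `e` and `f`. -/
def dist (e f : RamExp) : RamExp := add (sub e f) (sub f e)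

theorem Den.dist (he : Den Q s d e v a) (hf : Den Q s d f w b) :
    Den Q s d (RamExp.dist e f) ((v - w) + (w - v)) (max a b + 2) :=
  ((he.sub hf).add (hf.sub he)).weaken (by omega)

theorem Den.ite_of_iff {p : Prop} [Decidable p] {c g : RamExp} {u : ℕ} (hc : Den Q s d c u a)
    (hf : p → Den Q s d f v b) (hg : ¬ p → Den Q s d g w b) (hp : u ≠ 0 ↔ p) :
    Den Q s d (RamExp.ite c f g) (if p then v else w) (max a b + 1) := by
  refine (hc.ite (fun h => hf (hp.1 h)) fun h => hg fun h' => hp.2 h' h).congr ?_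
  by_cases h : p
  · rw [if_pos h, if_neg (hp.2 h)]
  · rw [if_neg h, if_pos (by by_contra h'; exact h (hp.1 h'))]

/-- The sum of the values of `f` at all numbers below the value of `n`. -/
def sum (n : RamExp) (f : RamExp → RamExp) : RamExp := fold n (const 0) fun X Y => add Y (f X)

theorem Den.sum {n : RamExp} {f : RamExp → RamExp} {N c : ℕ} {F : ℕ → ℕ}
    (hn : Den Q s d n N a) (hN : N ≤ Q)
    (hf : ∀ i < N, ∀ s₁ d₁, s.Extends d s₁ d₁ → ∀ X, Den Q s₁ d₁ X i 2 →
      Den Q s₁ d₁ (f X) (F i) c) :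
    Den Q s d (RamExp.sum n f) (∑ i ∈ Finset.range N, F i) (max a c + 6) := by
  -- The bound on the summands is already contained in the hypothesis on `f`: it is instantiated in
  -- a state where variable `d` has been set to `i`.
  have hF : ∀ i < N, F i ≤ Q ^ c := by
    intro i hi
    refine (hf i hi (s.setVar d i) (d + 1) ((extends_setVar s d i).trans (extends_add _ _ _))
      (RamExp.var d) (Den.var (by omega) (by simp [RamState.setVar]) ?_)).1
    rw [pow_one]; omega
  refine (Den.fold (b := c + 1) (c := c + 3) (g := fun N => ∑ i ∈ Finset.range N, F i) hn
    (by rw [Finset.sum_range_zero]; exact (Den.const _).weaken (by omega)) ?_ hN ?_).weaken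
    (by omega)
  · intro i hi s₁ d₁ hs X Y hX hY
    rw [Finset.sum_range_succ]
    exact (hY.add (hf i hi s₁ d₁ hs X hX)).weaken (by omega)
  · intro i hi
    calc ∑ j ∈ Finset.range i, F j ≤ ∑ j ∈ Finset.range i, Q ^ c :=
          Finset.sum_le_sum fun j hj => hF j (by rw [Finset.mem_range] at hj; omega)
      _ = i * Q ^ c := by simp
      _ ≤ Q * Q ^ c := by gcongr; omega
      _ = Q ^ (c + 1) := by ring

/-- The product. -/
def mul (e f : RamExp) : RamExp := sum e fun _ => f

theorem Den.mul (he : Den Q s d e v a) (hf : Den Q s d f w b) (hv : v ≤ Q) :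
    Den Q s d (RamExp.mul e f) (v * w) (max a b + 6) :=
  (Den.sum he hv fun _ _ _ _ hs _ _ => hf.mono hs).congr (by simp)

/-- The quotient. -/
def div (e f : RamExp) : RamExp := sum e fun X => le (mul (add X (const 1)) f) e

theorem card_filter_mul_le {v w : ℕ} (hw : 0 < w) :
    ∑ i ∈ Finset.range v, (if (i + 1) * w ≤ v then 1 else 0) = v / w := by
  rw [← Finset.card_filter]
  have : (Finset.range v).filter (fun i => (i + 1) * w ≤ v) = Finset.range (v / w) := by
    ext i
    simp only [Finset.mem_filter, Finset.mem_range, ← Nat.le_div_iff_mul_le hw]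
    have := Nat.div_le_self v w
    omega
  rw [this, Finset.card_range]

theorem Den.div (he : Den Q s d e v a) (hf : Den Q s d f w b) (hv : v ≤ Q) (hw : 0 < w) :
    Den Q s d (RamExp.div e f) (v / w) (max a b + 18) := by
  refine ((Den.sum (c := max a b + 12) he hv fun i hi s₁ d₁ hs X hX => ?_).weaken
    (by omega)).congr (card_filter_mul_le hw)
  exact (((hX.add (Den.const _)).mul (hf.mono hs) (by omega)).le (he.mono hs)).weaken (by omega)

/-- The remainder. -/
def mod (e f : RamExp) : RamExp := sub e (mul (div e f) f)

theorem Den.mod (he : Den Q s d e v a) (hf : Den Q s d f w b) (hv : v ≤ Q) (hw : 0 < w) :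
    Den Q s d (RamExp.mod e f) (v % w) (max a b + 25) := by
  refine ((he.sub ((he.div hf hv hw).mul hf ((Nat.div_le_self v w).trans hv))).weaken
    (by omega)).congr ?_
  rw [mul_comm, Nat.mod_eq_sub]

/-- The binary digit of `e` at position `f`. -/
def bit (e f : RamExp) : RamExp := mod (fold f e fun _ Y => div Y (const 2)) (const 2)

theorem Den.bit (he : Den Q s d e v a) (hf : Den Q s d f w b) (hv : v ≤ Q) (hw : w ≤ Q) :
    Den Q s d (RamExp.bit e f) (v / 2 ^ w % 2) (max a b + 60) := by
  have hQ : 32 ≤ Q := Fact.out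
  refine (Den.mod (Den.fold (b := a + 1) (c := a + 24) (g := fun i => v / 2 ^ i) hf
    ((he.weaken (by omega)).congr (by simp)) ?_ hw ?_) (Den.const _)
    ((Nat.div_le_self _ _).trans hv) (by norm_num)).weaken (by omega)
  · intro i _ s₁ d₁ _ X Y _ hY
    exact ((hY.div (Den.const _) ((Nat.div_le_self _ _).trans hv) (by norm_num)).weaken
      (by omega)).congr (by rw [Nat.div_div_eq_div_mul, pow_succ])
  · intro i _
    refine (Nat.div_le_self _ _).trans (hv.trans ?_)
    exact Nat.le_self_pow (by omega) Q

end

end RamExp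

/-! ### The algorithm -/

namespace CommitteeAlgorithm

open RamExp

/-- The number of candidates that a committee may have. -/
def committeeBound (w : ℕ → ℕ) : ℕ := min (w 3) (w 1)

/-- The number of votes that a committee needs. -/
def voteBound (w : ℕ → ℕ) : ℕ := min (w 4) (w 0 + 1)

/-- The number of candidates in which consecutive committees have to differ. -/
def diffBound (w : ℕ → ℕ) : ℕ := min (w 5) (committeeBound w + committeeBound w + 1)

/-- The ranks in which committees deviate from the best candidates are at most this far away from
the size of the committee. -/
def radius (w : ℕ → ℕ) : ℕ := 4 * diffBound w + 6

/-- The number of masks. -/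
def numMasks (w : ℕ → ℕ) : ℕ := 2 ^ (radius w + radius w)

/-- The vote of agent `v` in profile `i`. -/
def vote (w : ℕ → ℕ) (i v : ℕ) : ℕ := w (6 + w 0 + w 1 + w 2 + i * w 0 + v)

/-- The number of votes for candidate `c` in profile `i`. -/
def weight (w : ℕ → ℕ) (i c : ℕ) : ℕ :=
  ∑ v ∈ Finset.range (w 0), if vote w i v = c + 1 then 1 else 0

/-- The position of candidate `c` in the order by decreasing weight. -/
def rank (w : ℕ → ℕ) (i c : ℕ) : ℕ :=
  ∑ c' ∈ Finset.range (w 1),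
    if weight w i c < weight w i c' + (if c' < c then 1 else 0) then 1 else 0

/-- Whether candidate `c` belongs to the committee that is given by the mask `m`. -/
def member (w : ℕ → ℕ) (i m c : ℕ) : ℕ :=
  if rank w i c + radius w < committeeBound w then 1
  else m / 2 ^ (rank w i c + radius w - committeeBound w) % 2

/-- The size of the committee. -/
def committeeSize (w : ℕ → ℕ) (i m : ℕ) : ℕ := ∑ c ∈ Finset.range (w 1), member w i m c

/-- The number of votes for the committee. -/
def score (w : ℕ → ℕ) (i m : ℕ) : ℕ :=
  ∑ v ∈ Finset.range (w 0), if vote w i v ≠ 0 then member w i m (vote w i v - 1) else 0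

/-- The size of the symmetric difference of two committees. -/
def difference (w : ℕ → ℕ) (i m i' m' : ℕ) : ℕ :=
  ∑ c ∈ Finset.range (w 1), ((member w i m c - member w i' m' c) +
    (member w i' m' c - member w i m c))

/-- Whether the committee is small and has enough votes. -/
def Valid (w : ℕ → ℕ) (i m : ℕ) : Prop :=
  committeeSize w i m ≤ committeeBound w ∧ voteBound w ≤ score w i m

instance (w : ℕ → ℕ) (i m : ℕ) : Decidable (Valid w i m) := inferInstanceAs (Decidable (_ ∧ _))

/-- The entry with index `r` of the table `A` of all committees that end a feasible sequence,
computed from the earlier entries. -/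
def tableEntry (w A : ℕ → ℕ) (r : ℕ) : ℕ :=
  if Valid w (r / numMasks w) (r % numMasks w) then
    if r < numMasks w then 1
    else if 0 < ∑ m ∈ Finset.range (numMasks w),
      (if A ((r / numMasks w - 1) * numMasks w + m) ≠ 0 then
        if diffBound w ≤ difference w (r / numMasks w) (r % numMasks w) (r / numMasks w - 1) m
        then 1 else 0
      else 0) then 1 else 0
  else 0

/-- The answer, given the table. -/
def answer (w A : ℕ → ℕ) : ℕ :=
  if w 2 ≠ 0 then
    if 0 < ∑ m ∈ Finset.range (numMasks w), A ((w 2 - 1) * numMasks w + m) then 1 else 0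
  else 1

/-! ### Programs for the quantities defined above. -/

/-- Nothing is cached: weights, ranks and bounds are recomputed at each use. The nesting depth is
fixed, so this affects only the degree of the polynomial. -/
def numAgentsExp : RamExp := get 0 (const 0)
def numCandidatesExp : RamExp := get 0 (const 1)
def numProfilesExp : RamExp := get 0 (const 2)
def committeeBoundExp : RamExp := getMin 0 (const 3) numCandidatesExp
def voteBoundExp : RamExp := getMin 0 (const 4) (add numAgentsExp (const 1))
def diffBoundExp : RamExp :=
  getMin 0 (const 5) (add (add committeeBoundExp committeeBoundExp) (const 1))
def radiusExp : RamExp := add (mul (const 4) diffBoundExp) (const 6)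
def numMasksExp : RamExp := fold (add radiusExp radiusExp) (const 1) fun _ Y => add Y Y
def voteExp (i v : RamExp) : RamExp :=
  get 0 (add (add (add (add (add (const 6) numAgentsExp) numCandidatesExp) numProfilesExp)
    (mul i numAgentsExp)) v)
def weightExp (i c : RamExp) : RamExp :=
  sum numAgentsExp fun v => ite (dist (voteExp i v) (add c (const 1))) (const 0) (const 1)
def rankExp (i c : RamExp) : RamExp :=
  sum numCandidatesExp fun c' => lt (weightExp i c) (add (weightExp i c') (lt c' c))
def memberExp (i m c : RamExp) : RamExp :=
  ite (lt (add (rankExp i c) radiusExp) committeeBoundExp) (const 1)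
    (bit m (sub (add (rankExp i c) radiusExp) committeeBoundExp))
def committeeSizeExp (i m : RamExp) : RamExp := sum numCandidatesExp fun c => memberExp i m c
def scoreExp (i m : RamExp) : RamExp :=
  sum numAgentsExp fun v =>
    ite (voteExp i v) (memberExp i m (sub (voteExp i v) (const 1))) (const 0)
def differenceExp (i m i' m' : RamExp) : RamExp :=
  sum numCandidatesExp fun c => dist (memberExp i m c) (memberExp i' m' c)
def validExp (i m : RamExp) : RamExp :=
  ite (le (committeeSizeExp i m) committeeBoundExp) (le voteBoundExp (scoreExp i m)) (const 0)
def tableEntryExp (r : RamExp) : RamExp :=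
  ite (validExp (div r numMasksExp) (mod r numMasksExp))
    (ite (lt r numMasksExp) (const 1) (lt (const 0) (sum numMasksExp fun m =>
      ite (get 1 (add (mul (sub (div r numMasksExp) (const 1)) numMasksExp) m))
        (le diffBoundExp (differenceExp (div r numMasksExp) (mod r numMasksExp)
          (sub (div r numMasksExp) (const 1)) m)) (const 0))))
    (const 0)
def answerExp : RamExp :=
  ite numProfilesExp (lt (const 0) (sum numMasksExp fun m =>
    get 1 (add (mul (sub numProfilesExp (const 1)) numMasksExp) m))) (const 1)

/-- The input `w` is stored in array `0`, array `1` holds truth values, and `Q` is a bound for the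
relevant numbers. -/
structure Input (Q : ℕ) (w : ℕ → ℕ) (s : RamState) : Prop where
  arr : s.arr 0 = w
  table : ∀ j, s.arr 1 j ≤ 1
  agents : w 0 ≤ Q
  candidates : w 1 ≤ Q
  profiles : w 2 ≤ Q
  size : ∀ j, (w j).size ≤ Q
  votes : ∀ j, 6 ≤ j → w j ≤ Q
  radius : w 1 + (radius w + radius w) ≤ Q
  masks : numMasks w ≤ Q

theorem Input.extends {Q : ℕ} {w : ℕ → ℕ} {s s₁ : RamState} {d d₁ : ℕ} (h : Input Q w s)
    (hs : s.Extends d s₁ d₁) : Input Q w s₁ :=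
  { h with arr := by rw [hs.arr]; exact h.arr
           table := by rw [hs.arr]; exact h.table }

theorem rank_le (w : ℕ → ℕ) (i c : ℕ) : rank w i c ≤ w 1 := by
  unfold rank
  refine (Finset.sum_le_card_nsmul _ _ 1 fun c' _ => ?_).trans (by simp)
  split_ifs <;> simp

theorem numMasks_pos (w : ℕ → ℕ) : 0 < numMasks w := Nat.two_pow_pos _

/-! ### Values and costs of these programs; the exponents are generous upper bounds. -/

section

variable {Q : ℕ} [Fact (32 ≤ Q)] {w : ℕ → ℕ} {s : RamState} {d a : ℕ}
  {i m c i' m' v : RamExp} {iv mv cv iv' mv' vv : ℕ}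

theorem den_numAgents (I : Input Q w s) : Den Q s d numAgentsExp (w 0) 2 :=
  (Den.const _).get (b := 1) (by rw [I.arr]) (by rw [pow_one]; exact I.agents)

theorem den_numCandidates (I : Input Q w s) : Den Q s d numCandidatesExp (w 1) 2 :=
  (Den.const _).get (b := 1) (by rw [I.arr]) (by rw [pow_one]; exact I.candidates)

theorem den_numProfiles (I : Input Q w s) : Den Q s d numProfilesExp (w 2) 2 :=
  (Den.const _).get (b := 1) (by rw [I.arr]) (by rw [pow_one]; exact I.profiles)

theorem den_committeeBound (I : Input Q w s) :
    Den Q s d committeeBoundExp (committeeBound w) 4 :=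
  ((Den.const _).getMin (den_numCandidates I) (by rw [I.arr]) (I.size 3)).weaken (by omega)

theorem den_voteBound (I : Input Q w s) : Den Q s d voteBoundExp (voteBound w) 6 :=
  ((Den.const _).getMin ((den_numAgents I).add (Den.const _)) (by rw [I.arr]) (I.size 4)).weaken (by omega)

theorem den_diffBound (I : Input Q w s) : Den Q s d diffBoundExp (diffBound w) 8 :=
  ((Den.const _).getMin (((den_committeeBound I).add (den_committeeBound I)).add (Den.const _))
    (by rw [I.arr]) (I.size 5)).weaken (by omega)

theorem den_radius (I : Input Q w s) : Den Q s d radiusExp (radius w) 15 := by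
  have hQ : 32 ≤ Q := Fact.out
  exact (((Den.const _).mul (den_diffBound I) (by omega)).add (Den.const _)).weaken (by omega)

theorem den_numMasks (I : Input Q w s) : Den Q s d numMasksExp (numMasks w) 20 := by
  have hr := I.radius
  refine (Den.fold (b := 1) (c := 3) (g := fun i => 2 ^ i)
    ((den_radius I).add (den_radius I)) (Den.const _) ?_ (by omega) ?_).weaken (by omega)
  · intro i _ s₁ d₁ _ X Y _ hY
    exact ((hY.add hY).weaken (by omega)).congr (by ring)
  · intro i hi
    rw [pow_one]
    exact (Nat.pow_le_pow_right (by norm_num) hi).trans I.masks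

theorem den_vote (I : Input Q w s) (hi : Den Q s d i iv a) (hv : Den Q s d v vv a)
    (hiQ : iv ≤ Q) : Den Q s d (voteExp i v) (vote w iv vv) (a + 20) :=
  (((((((((Den.const _).add (den_numAgents I)).add (den_numCandidates I)).add
    (den_numProfiles I)).add (hi.mul (den_numAgents I) hiQ)).add hv).get (b := 1)
    (by rw [I.arr]; rfl)) (by rw [pow_one]; exact I.votes _ (by omega)))).weaken (by omega)

theorem den_weight (I : Input Q w s) (hi : Den Q s d i iv a) (hc : Den Q s d c cv a)
    (hiQ : iv ≤ Q) : Den Q s d (weightExp i c) (weight w iv cv) (a + 35) := by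
  refine (Den.sum (c := a + 28) (den_numAgents I) I.agents fun j _ s₁ d₁ hs X hX => ?_).weaken
    (by omega)
  refine (((den_vote (a := a + 2) (I.extends hs) ((hi.mono hs).weaken (by omega))
    (hX.weaken (by omega)) hiQ).dist ((hc.mono hs).add (Den.const _))).ite (b := 1)
    (fun _ => (Den.const _)) fun _ => (Den.const _)).weaken (by omega) |>.congr ?_
  split_ifs <;> omega

theorem den_rank (I : Input Q w s) (hi : Den Q s d i iv a) (hc : Den Q s d c cv a)
    (hiQ : iv ≤ Q) : Den Q s d (rankExp i c) (rank w iv cv) (a + 60) := by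
  refine (Den.sum (c := a + 50) (den_numCandidates I) I.candidates
    fun j _ s₁ d₁ hs X hX => ?_).weaken (by omega)
  have J := I.extends hs
  exact ((den_weight J (hi.mono hs) (hc.mono hs) hiQ).lt
    ((den_weight (a := a + 2) J ((hi.mono hs).weaken (by omega)) (hX.weaken (by omega)) hiQ).add
      (hX.lt (hc.mono hs)))).weaken (by omega)

theorem den_member (I : Input Q w s) (hi : Den Q s d i iv a) (hm : Den Q s d m mv a)
    (hc : Den Q s d c cv a) (hiQ : iv ≤ Q) (hmQ : mv ≤ Q) :
    Den Q s d (memberExp i m c) (member w iv mv cv) (a + 140) := by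
  have h := (den_rank I hi hc hiQ).add (den_radius I)
  -- Extracting a bit halves the mask as often as the position says, so the position must be at most
  -- `Q`; this follows from `rank_le` and `I.radius`.
  have hle := rank_le w iv cv
  have hr := I.radius
  refine ((h.lt (den_committeeBound I)).ite_of_iff (b := a + 130) (fun _ => (Den.const _).weaken
    (by omega)) (fun _ => ?_) (by split_ifs <;> simp_all)).weaken (by omega)
  exact (hm.bit (h.sub (den_committeeBound I)) hmQ (by omega)).weaken (by omega)

theorem den_committeeSize (I : Input Q w s) (hi : Den Q s d i iv a) (hm : Den Q s d m mv a)
    (hiQ : iv ≤ Q) (hmQ : mv ≤ Q) :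
    Den Q s d (committeeSizeExp i m) (committeeSize w iv mv) (a + 150) :=
  (Den.sum (c := a + 142) (den_numCandidates I) I.candidates fun j _ s₁ d₁ hs X hX =>
    den_member (a := a + 2) (I.extends hs) ((hi.mono hs).weaken (by omega))
      ((hm.mono hs).weaken (by omega)) (hX.weaken (by omega)) hiQ hmQ).weaken (by omega)

theorem den_score (I : Input Q w s) (hi : Den Q s d i iv a) (hm : Den Q s d m mv a)
    (hiQ : iv ≤ Q) (hmQ : mv ≤ Q) :
    Den Q s d (scoreExp i m) (score w iv mv) (a + 180) := by
  refine (Den.sum (c := a + 172) (den_numAgents I) I.agents fun j _ s₁ d₁ hs X hX => ?_).weaken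
    (by omega)
  have J := I.extends hs
  have h := den_vote (a := a + 2) J ((hi.mono hs).weaken (by omega)) (hX.weaken (by omega)) hiQ
  exact (h.ite_of_iff (b := a + 170) (fun _ => (den_member (a := a + 25) J
    ((hi.mono hs).weaken (by omega)) ((hm.mono hs).weaken (by omega))
    ((h.sub (Den.const _)).weaken (by omega)) hiQ hmQ).weaken (by omega))
    (fun _ => (Den.const _).weaken (by omega)) Iff.rfl).weaken (by omega)

theorem den_difference (I : Input Q w s) (hi : Den Q s d i iv a) (hm : Den Q s d m mv a)
    (hi' : Den Q s d i' iv' a) (hm' : Den Q s d m' mv' a)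
    (hiQ : iv ≤ Q) (hmQ : mv ≤ Q) (hiQ' : iv' ≤ Q) (hmQ' : mv' ≤ Q) :
    Den Q s d (differenceExp i m i' m') (difference w iv mv iv' mv') (a + 160) := by
  refine (Den.sum (c := a + 150) (den_numCandidates I) I.candidates
    fun j _ s₁ d₁ hs X hX => ?_).weaken (by omega)
  have J := I.extends hs
  exact ((den_member (a := a + 2) J ((hi.mono hs).weaken (by omega))
    ((hm.mono hs).weaken (by omega)) (hX.weaken (by omega)) hiQ hmQ).dist
    (den_member (a := a + 2) J ((hi'.mono hs).weaken (by omega))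
    ((hm'.mono hs).weaken (by omega)) (hX.weaken (by omega)) hiQ' hmQ')).weaken (by omega)

theorem den_valid (I : Input Q w s) (hi : Den Q s d i iv a) (hm : Den Q s d m mv a)
    (hiQ : iv ≤ Q) (hmQ : mv ≤ Q) :
    Den Q s d (validExp i m) (if Valid w iv mv then 1 else 0) (a + 190) := by
  refine ((((den_committeeSize I hi hm hiQ hmQ).le (den_committeeBound I)).ite_of_iff
    (p := committeeSize w iv mv ≤ committeeBound w) (b := a + 186)
    (fun _ => ((den_voteBound I).le (den_score I hi hm hiQ hmQ)).weaken (by omega))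
    (fun _ => (Den.const _).weaken (by omega)) (by split_ifs <;> simp_all)).weaken (by omega)).congr ?_
  by_cases h₁ : committeeSize w iv mv ≤ committeeBound w <;>
    by_cases h₂ : voteBound w ≤ score w iv mv <;> simp [Valid, h₁, h₂]

/-- The value is expressed through the current contents of array `1`, whether or not they are
correct yet; evaluation needs only that they are truth values. -/
theorem den_tableEntry {r : RamExp} {rv : ℕ} (I : Input Q w s) (hr : Den Q s d r rv 2)
    (hrQ : rv ≤ Q) : Den Q s d (tableEntryExp r) (tableEntry w (s.arr 1) rv) 300 := by
  have hM := numMasks_pos w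
  have hdQ : rv / numMasks w ≤ Q := (Nat.div_le_self _ _).trans hrQ
  have hmQ : rv % numMasks w ≤ Q := (Nat.mod_le _ _).trans hrQ
  have hdiv : Den Q s d (div r numMasksExp) (rv / numMasks w) 60 :=
    (hr.div (den_numMasks I) hrQ hM).weaken (by omega)
  have hmod : Den Q s d (mod r numMasksExp) (rv % numMasks w) 60 :=
    (hr.mod (den_numMasks I) hrQ hM).weaken (by omega)
  have hpred : Den Q s d (sub (div r numMasksExp) (const 1)) (rv / numMasks w - 1) 61 :=
    (hdiv.sub (Den.const _)).weaken (by omega)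
  refine ((den_valid I hdiv hmod hdQ hmQ).ite_of_iff (b := 290) (fun _ => ?_)
    (fun _ => (Den.const _).weaken (by omega)) (by split_ifs <;> simp_all)).weaken (by omega)
  refine ((hr.lt (den_numMasks I)).ite_of_iff (b := 280) (fun _ => (Den.const _).weaken (by omega))
    (fun _ => ?_) (by split_ifs <;> simp_all)).weaken (by omega)
  refine ((Den.const _).lt (Den.sum (c := 260) (den_numMasks I) I.masks
    fun j hj s₁ d₁ hs X hX => ?_)).weaken (by omega)
  have J := I.extends hs
  refine (((((hpred.mono hs).mul (den_numMasks J) (by omega)).add hX).get (b := 1)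
    (by rw [hs.arr]) ?_).ite_of_iff (b := 250) (fun _ => ?_)
    (fun _ => (Den.const _).weaken (by omega)) Iff.rfl).weaken (by omega)
  · have hQ : 32 ≤ Q := Fact.out
    have := I.table ((rv / numMasks w - 1) * numMasks w + j)
    rw [pow_one]; omega
  · have hjQ : j ≤ Q := hj.le.trans I.masks
    exact ((den_diffBound J).le (den_difference (a := 61) J ((hdiv.mono hs).weaken (by omega))
      ((hmod.mono hs).weaken (by omega)) (hpred.mono hs) (hX.weaken (by omega)) hdQ hmQ
      (by omega) hjQ)).weaken (by omega)

theorem den_answer (I : Input Q w s) : Den Q s d answerExp (answer w (s.arr 1)) 100 := by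
  have hw := I.profiles
  refine ((den_numProfiles I).ite_of_iff (b := 90) (fun _ => ?_)
    (fun _ => (Den.const _).weaken (by omega)) Iff.rfl).weaken (by omega)
  refine ((Den.const _).lt (Den.sum (c := 60) (den_numMasks I) I.masks
    fun j hj s₁ d₁ hs X hX => ?_)).weaken (by omega)
  have J := I.extends hs
  refine (((((den_numProfiles J).sub (Den.const _)).mul (den_numMasks J) (by omega)).add hX).get
    (b := 1) (by rw [hs.arr]) ?_).weaken (by omega)
  have hQ : 32 ≤ Q := Fact.out
  have := I.table ((w 2 - 1) * numMasks w + j)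
  rw [pow_one]; omega

end

end CommitteeAlgorithm

/-! ### Correctness of the dynamic program and of the loop that fills its table. -/

namespace CommitteeAlgorithm

open RamExp

/-- The committee with mask `m` in profile `i` ends a feasible sequence of committees for the
profiles up to `i`. -/
def Reachable (w : ℕ → ℕ) : ℕ → ℕ → Prop
  | 0, m => Valid w 0 m
  | i + 1, m => Valid w (i + 1) m ∧ ∃ m' < numMasks w, Reachable w i m' ∧
      diffBound w ≤ difference w (i + 1) m i m'

open Classical in
/-- The table of all committees that end a feasible sequence. -/
noncomputable def table (w : ℕ → ℕ) (r : ℕ) : ℕ :=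
  if Reachable w (r / numMasks w) (r % numMasks w) then 1 else 0

theorem table_mul_add (w : ℕ → ℕ) (i : ℕ) {m : ℕ} (hm : m < numMasks w) :
    table w (i * numMasks w + m) ≠ 0 ↔ Reachable w i m := by
  have h1 : (i * numMasks w + m) / numMasks w = i := by
    rw [mul_comm, Nat.mul_add_div (numMasks_pos w), Nat.div_eq_of_lt hm, add_zero]
  have h2 : (i * numMasks w + m) % numMasks w = m := by
    rw [mul_comm, Nat.mul_add_mod, Nat.mod_eq_of_lt hm]
  simp [table, h1, h2]

theorem table_le_one (w : ℕ → ℕ) (r : ℕ) : table w r ≤ 1 := by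
  unfold table; split_ifs <;> simp

/-- The recurrence for profile `i + 1` reads only the row of profile `i`, whose indices are all
below `r`. So filling the table in increasing order of `r` is sound, and later cells may hold
anything. -/
theorem tableEntry_eq {w A : ℕ → ℕ} {r : ℕ} (hA : ∀ j < r, A j = table w j) :
    tableEntry w A r = table w r := by
  have hM := numMasks_pos w
  by_cases hr : r < numMasks w
  · simp [tableEntry, table, Nat.div_eq_of_lt hr, Nat.mod_eq_of_lt hr, Reachable, hr]
  · obtain ⟨i, hi⟩ : ∃ i, r / numMasks w = i + 1 :=
      ⟨r / numMasks w - 1, by have := Nat.div_pos (not_lt.1 hr) hM; omega⟩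
    have hlt : ∀ m < numMasks w, i * numMasks w + m < r := by
      intro m hm
      have := Nat.div_add_mod r (numMasks w)
      rw [hi, Nat.mul_succ, mul_comm] at this
      omega
    have hex : (0 < ∑ m ∈ Finset.range (numMasks w), (if A (i * numMasks w + m) ≠ 0 then
        if diffBound w ≤ difference w (i + 1) (r % numMasks w) i m then 1 else 0 else 0)) ↔
        ∃ m < numMasks w, Reachable w i m ∧
          diffBound w ≤ difference w (i + 1) (r % numMasks w) i m := by
      rw [Finset.sum_pos_iff]
      refine exists_congr fun m => ?_
      rw [Finset.mem_range]
      refine and_congr_right fun hm => ?_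
      rw [hA _ (hlt m hm), ← table_mul_add w i hm]
      split_ifs <;> simp_all
    have hR : Reachable w (i + 1) (r % numMasks w) ↔ Valid w (i + 1) (r % numMasks w) ∧
        ∃ m < numMasks w, Reachable w i m ∧
          diffBound w ≤ difference w (i + 1) (r % numMasks w) i m := Iff.rfl
    unfold tableEntry table
    rw [hi, Nat.add_sub_cancel, if_neg hr]
    by_cases hv : Valid w (i + 1) (r % numMasks w)
    · rw [if_pos hv]
      by_cases he : ∃ m < numMasks w, Reachable w i m ∧
          diffBound w ≤ difference w (i + 1) (r % numMasks w) i m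
      · rw [if_pos (hex.2 he), if_pos (hR.2 ⟨hv, he⟩)]
      · rw [if_neg (fun h => he (hex.1 h)), if_neg (fun h => he (hR.1 h).2)]
    · rw [if_neg hv, if_neg (fun h => hv (hR.1 h).1)]

/-- The program. -/
def program : RamProgram :=
  .seq (.seq (.seq (mul numProfilesExp numMasksExp 1) (.const 2 0)) (.const 3 1))
    (.seq (.loop 1 (.seq (.seq (tableEntryExp (var 2) 4) (.store 1 2 4))
      (.seq (.add 2 2 3) (.sub 1 1 3)))) (answerExp 0))

theorem Input.setArr {Q : ℕ} {w : ℕ → ℕ} {s : RamState} (h : Input Q w s) (j v : ℕ)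
    (hv : v ≤ 1) : Input Q w (s.setArr 1 j v) :=
  { h with
    arr := by simpa [RamState.setArr] using h.arr
    table := by
      intro i
      by_cases hi : i = j
      · subst hi; simpa [RamState.setArr] using hv
      · simpa [RamState.setArr, hi] using h.table i }

theorem Input.of_arr {Q : ℕ} {w : ℕ → ℕ} {s s' : RamState} (h : Input Q w s)
    (hs : s'.arr = s.arr) : Input Q w s' :=
  { h with arr := by rw [hs]; exact h.arr
           table := by rw [hs]; exact h.table }

-- Loop invariant: variable `1` counts the entries still to be computed, variable `2` is the next
-- index, variable `3` is one, and all earlier entries are correct. Each round costs one evaluation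
-- of `tableEntryExp`, at most `Q ^ 300`, and some bookkeeping that fits into a second `Q ^ 300`.
set_option exponentiation.threshold 400 in
theorem loop_correct {Q : ℕ} [Fact (32 ≤ Q)] {w : ℕ → ℕ} {R : ℕ} (hR : R ≤ Q) (r : ℕ) :
    ∀ s : RamState, r ≤ R → Input Q w s → s.var 1 = r → s.var 2 = R - r → s.var 3 = 1 →
      (∀ j < R - r, s.arr 1 j = table w j) →
      ∃ t s', RamExec (.loop 1 (.seq (.seq (tableEntryExp (var 2) 4) (.store 1 2 4))
        (.seq (.add 2 2 3) (.sub 1 1 3)))) s t s' ∧ t ≤ r * (2 * Q ^ 300) + 1 ∧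
        Input Q w s' ∧ ∀ j < R, s'.arr 1 j = table w j := by
  have hQ : 32 ≤ Q := Fact.out
  induction r with
  | zero =>
    intro s _ I h1 h2 h3 hA
    exact ⟨_, _, RamExec.loopStop h1, by simp [h1], I, hA⟩
  | succ r ih =>
    intro s hr I h1 h2 h3 hA
    have hvar : Den Q s 4 (var 2) (R - (r + 1)) 2 :=
      Den.var (by norm_num) h2 (by rw [pow_one]; omega)
    obtain ⟨t, s₁, e1, e2, e3, e4⟩ :=
      (den_tableEntry I hvar (by omega)).2 s 4 (extends_refl _ _)
    rw [tableEntry_eq hA] at e3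
    have v1 : s₁.var 1 = r + 1 := by rw [e4.var _ (by norm_num), h1]
    have v2 : s₁.var 2 = R - (r + 1) := by rw [e4.var _ (by norm_num), h2]
    have v3 : s₁.var 3 = 1 := by rw [e4.var _ (by norm_num), h3]
    have hir : R - (r + 1) + 1 = R - r := by omega
    have hbody := (e1.seq (RamExec.store s₁ 1 2 4)).seq
      ((RamExec.add _ 2 2 3).seq (RamExec.sub _ 1 1 3))
    simp [RamState.setVar, RamState.setArr, v1, v2, v3, e3, hir] at hbody
    obtain ⟨t', s₂, l1, l2, l3, l4⟩ := ih
      (((s₁.setArr 1 (R - (r + 1)) (table w (R - (r + 1)))).setVar 2 (R - r)).setVar 1 r)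
      (by omega) (((I.extends e4).setArr _ _ (table_le_one w _)).of_arr rfl)
      (by simp [RamState.setVar]) (by simp [RamState.setVar])
      (by simp [RamState.setVar, RamState.setArr, v3])
      (by
        intro j hj
        by_cases hjr : j = R - (r + 1)
        · subst hjr; simp [RamState.setVar, RamState.setArr]
        · simp only [RamState.setVar, RamState.setArr, Function.update_self,
            Function.update_of_ne hjr]
          rw [e4.arr]
          exact hA j (by omega))
    simp only [RamState.setVar, RamState.setArr] at l1
    refine ⟨_, _, RamExec.loopStep (by omega) hbody l1, ?_, l3, l4⟩
    have s1 := size_le_self (R - (r + 1))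
    have s2 := size_le_self (table w (R - (r + 1)))
    have s3 := size_le_self (r + 1)
    have s4 := table_le_one w (R - (r + 1))
    have p : Q ^ 2 ≤ Q ^ 300 := Nat.pow_le_pow_right (by omega) (by norm_num)
    have p' : 32 * Q ≤ Q ^ 2 := by rw [pow_two]; gcongr
    rw [h1, Nat.succ_mul]
    generalize Q ^ 300 = B at *
    omega

-- At most `Q` rounds of cost `2 * Q ^ 300` dominate; the last factor `Q` absorbs initialization and
-- the final answer.
set_option exponentiation.threshold 400 in
theorem program_correct {Q : ℕ} [Fact (32 ≤ Q)] {w : ℕ → ℕ} {s : RamState} (I : Input Q w s)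
    (hR : w 2 * numMasks w ≤ Q) :
    ∃ t s' A, RamExec program s t s' ∧ t ≤ Q ^ 302 ∧ s'.var 0 = answer w A ∧
      ∀ j < w 2 * numMasks w, A j = table w j := by
  have hQ : 32 ≤ Q := Fact.out
  obtain ⟨t, s₁, e1, e2, e3, e4⟩ :=
    (((den_numProfiles (d := 1) I).mul (den_numMasks I) I.profiles)).2 s 1 (extends_refl _ _)
  have hinit := (e1.seq (RamExec.const s₁ 2 0)).seq (RamExec.const _ 3 1)
  obtain ⟨t', s₂, l1, l2, l3, l4⟩ := loop_correct hR (w 2 * numMasks w)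
    ((s₁.setVar 2 0).setVar 3 1) le_rfl ((I.extends e4).of_arr rfl)
    (by simp [RamState.setVar, e3]) (by simp [RamState.setVar]) (by simp [RamState.setVar])
    (by intro j hj; omega)
  obtain ⟨t'', s₃, a1, a2, a3, -⟩ := (den_answer (d := 0) l3).2 s₂ 0 (extends_refl _ _)
  refine ⟨_, s₃, s₂.arr 1, hinit.seq (l1.seq a1), ?_, a3, l4⟩
  have p1 : Q ^ (max 2 20 + 6) ≤ Q ^ 300 := Nat.pow_le_pow_right (by omega) (by norm_num)
  have p2 : Q ^ 100 ≤ Q ^ 300 := Nat.pow_le_pow_right (by omega) (by norm_num)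
  have p3 : w 2 * numMasks w * (2 * Q ^ 300) ≤ 2 * Q ^ 301 := by
    calc w 2 * numMasks w * (2 * Q ^ 300) ≤ Q * (2 * Q ^ 300) := by gcongr
      _ = 2 * Q ^ 301 := by ring
  have p4 : Q ^ 300 ≤ Q ^ 301 := Nat.pow_le_pow_right (by omega) (by norm_num)
  have p5 : 32 * Q ^ 301 ≤ Q ^ 302 := by
    calc 32 * Q ^ 301 ≤ Q * Q ^ 301 := by gcongr
      _ = Q ^ 302 := by ring
  have p6 : 1 ≤ Q ^ 300 := Nat.one_le_pow _ _ (by omega)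
  generalize Q ^ 302 = B₂ at *
  generalize Q ^ 301 = B₁ at *
  generalize Q ^ 300 = B at *
  simp only [Nat.size_one, Nat.size_zero]
  omega

theorem answer_correct {w A : ℕ → ℕ} (hA : ∀ j < w 2 * numMasks w, A j = table w j) :
    ((w 2 = 0 ∨ ∃ m < numMasks w, Reachable w (w 2 - 1) m) → answer w A = 1) ∧
    (¬ (w 2 = 0 ∨ ∃ m < numMasks w, Reachable w (w 2 - 1) m) → answer w A = 0) := by
  by_cases h : w 2 = 0
  · simp [answer, h]
  · have hex : (0 < ∑ m ∈ Finset.range (numMasks w), A ((w 2 - 1) * numMasks w + m)) ↔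
        ∃ m < numMasks w, Reachable w (w 2 - 1) m := by
      rw [Finset.sum_pos_iff]
      refine exists_congr fun m => ?_
      rw [Finset.mem_range]
      refine and_congr_right fun hm => ?_
      rw [hA _ ?_, ← table_mul_add w _ hm, Nat.pos_iff_ne_zero]
      obtain ⟨i, hi⟩ := Nat.exists_eq_succ_of_ne_zero h
      rw [hi, Nat.succ_sub_one, Nat.succ_mul]
      omega
    rw [answer, if_pos h]
    exact ⟨fun h' => if_pos (hex.2 (h'.resolve_left h)),
      fun h' => if_neg fun h'' => h' (Or.inr (hex.1 h''))⟩

theorem Reachable.exists_sequence {w : ℕ → ℕ} {i : ℕ} : ∀ {m : ℕ}, Reachable w i m →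
    ∃ f : ℕ → ℕ, f i = m ∧ (∀ j ≤ i, Valid w j (f j)) ∧
      ∀ j < i, diffBound w ≤ difference w (j + 1) (f (j + 1)) j (f j) := by
  induction i with
  | zero =>
    intro m h
    exact ⟨fun _ => m, rfl, fun j hj => by rw [Nat.le_zero.1 hj]; exact h, by simp⟩
  | succ i ih =>
    rintro m ⟨hv, m', -, hm', hd⟩
    obtain ⟨f, hf, h1, h2⟩ := ih hm'
    refine ⟨Function.update f (i + 1) m, by simp, fun j hj => ?_, fun j hj => ?_⟩
    · by_cases hji : j = i + 1
      · subst hji; simpa using hv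
      · rw [Function.update_of_ne hji]; exact h1 j (by omega)
    · rw [Function.update_of_ne (by omega : j ≠ i + 1)]
      by_cases hji : j = i
      · subst hji; rw [Function.update_self, hf]; exact hd
      · rw [Function.update_of_ne (by omega)]; exact h2 j (by omega)

theorem reachable_of_sequence {w : ℕ → ℕ} {f : ℕ → ℕ} {τ : ℕ} (hf : ∀ j < τ, f j < numMasks w)
    (hv : ∀ j < τ, Valid w j (f j))
    (hd : ∀ j, j + 1 < τ → diffBound w ≤ difference w (j + 1) (f (j + 1)) j (f j)) (i : ℕ) :
    i < τ → Reachable w i (f i) := by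
  induction i with
  | zero => exact hv 0
  | succ i ih => exact fun hi => ⟨hv _ hi, f i, hf i (by omega), ih (by omega), hd i hi⟩

end CommitteeAlgorithm

/-! ### The ranking of candidates and the committees described by masks. -/

namespace CommitteeAlgorithm

section

variable {w : ℕ → ℕ} {n : ℕ}

theorem rank_eq_card (hn : w 1 = n) (i c : ℕ) :
    rank w i c = (Finset.univ.filter fun c' : Fin n =>
      weight w i c < weight w i c' + (if (c' : ℕ) < c then 1 else 0)).card := by
  rw [rank, hn, Finset.sum_range, ← Finset.card_filter]

/-- The hypothesis says that `c` precedes `c'` when ties in weight are broken by index. This order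
is transitive, so whatever precedes `c` also precedes `c'`, and `c` itself is an additional
predecessor of `c'`. -/
theorem rank_lt_rank (hn : w 1 = n) (i : ℕ) {c c' : Fin n}
    (h : weight w i c' < weight w i c + (if (c : ℕ) < c' then 1 else 0)) :
    rank w i c < rank w i c' := by
  rw [rank_eq_card hn, rank_eq_card hn]
  refine Finset.card_lt_card (Finset.ssubset_iff_of_subset ?_ |>.2 ⟨c, ?_, ?_⟩)
  · intro x hx
    simp only [Finset.mem_filter, Finset.mem_univ, true_and] at hx ⊢
    split_ifs at * <;> omega
  · simpa using h
  · simp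

theorem rank_injective (hn : w 1 = n) (i : ℕ) :
    Function.Injective fun c : Fin n => rank w i c := by
  intro c c' h
  by_contra hne
  have hne' : (c : ℕ) ≠ c' := fun h => hne (Fin.ext h)
  simp only at h
  by_cases h1 : weight w i c' < weight w i c + (if (c : ℕ) < c' then 1 else 0)
  · have := rank_lt_rank hn i h1
    omega
  · have h2 : weight w i c < weight w i c' + (if (c' : ℕ) < c then 1 else 0) := by
      split_ifs at * <;> omega
    have := rank_lt_rank hn i h2
    omega

theorem rank_lt (hn : w 1 = n) (i : ℕ) (c : Fin n) : rank w i c < n := by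
  rw [rank_eq_card hn]
  refine (Finset.card_lt_card (Finset.filter_ssubset.2 ⟨c, Finset.mem_univ _, ?_⟩)).trans_eq ?_
  · simp
  · simp

theorem weight_le_of_rank_lt (hn : w 1 = n) (i : ℕ) {c c' : Fin n}
    (h : rank w i c < rank w i c') : weight w i c' ≤ weight w i c := by
  by_contra hcon
  have := rank_lt_rank hn i (c := c') (c' := c) (by omega)
  omega

/-- Ties being broken, the rank is an injection of `Fin n` into itself, hence a bijection. -/
theorem card_rank_lt (hn : w 1 = n) (i : ℕ) {j : ℕ} (hj : j ≤ n) :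
    (Finset.univ.filter fun c : Fin n => rank w i c < j).card = j := by
  have hbij : Function.Bijective fun c : Fin n => (⟨rank w i c, rank_lt hn i c⟩ : Fin n) :=
    (Finite.injective_iff_bijective).1 fun c c' h =>
      rank_injective hn i (by simpa using h)
  have h1 : (Finset.univ.filter fun c : Fin n => rank w i c < j).card =
      (Finset.univ.filter fun c : Fin n => (c : ℕ) < j).card :=
    Finset.card_bijective _ hbij fun c => by simp
  rw [h1, Fin.card_filter_val_lt, min_eq_right hj]

theorem member_le_one (w : ℕ → ℕ) (i m c : ℕ) : member w i m c ≤ 1 := by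
  unfold member
  split_ifs <;> omega

/-- The committee with mask `m` in profile `i`. -/
def committee (w : ℕ → ℕ) (n i m : ℕ) : Finset (Fin n) :=
  Finset.univ.filter fun c => member w i m c = 1

theorem member_eq (w : ℕ → ℕ) (i m : ℕ) (c : Fin n) :
    member w i m c = if c ∈ committee w n i m then 1 else 0 := by
  have := member_le_one w i m c
  simp only [committee, Finset.mem_filter, Finset.mem_univ, true_and]
  split_ifs <;> omega

theorem committeeSize_eq (hn : w 1 = n) (i m : ℕ) :
    committeeSize w i m = (committee w n i m).card := by
  rw [committeeSize, hn, Finset.sum_range]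
  simp only [member_eq, ← Finset.card_filter, Finset.filter_univ_mem]

theorem difference_eq (hn : w 1 = n) (i m i' m' : ℕ) :
    difference w i m i' m' = (symmDiff (committee w n i m) (committee w n i' m')).card := by
  rw [difference, hn, Finset.sum_range, ← Finset.filter_univ_mem (symmDiff _ _),
    Finset.card_filter]
  refine Finset.sum_congr rfl fun c _ => ?_
  rw [member_eq, member_eq]
  simp only [Finset.mem_symmDiff]
  split_ifs <;> simp_all

/-- Every committee that deviates from the best candidates only near the last position is given
by a mask. -/
theorem exists_mask (hn : w 1 = n) (i : ℕ) (S : Finset (Fin n))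
    (hS : ∀ c : Fin n, (rank w i c + radius w < committeeBound w → c ∈ S) ∧
      (c ∈ S → rank w i c < committeeBound w + radius w)) :
    ∃ m < numMasks w, committee w n i m = S := by
  classical
  refine ⟨Nat.ofBits fun j : Fin (radius w + radius w) =>
    decide (∃ c ∈ S, rank w i c + radius w = committeeBound w + j), Nat.ofBits_lt_two_pow _, ?_⟩
  ext c
  simp only [committee, Finset.mem_filter, Finset.mem_univ, true_and]
  unfold member
  split_ifs with h
  · simp [(hS c).1 h]
  · obtain ⟨j, hj⟩ : ∃ j, j = rank w i c + radius w - committeeBound w := ⟨_, rfl⟩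
    rw [← hj]
    have hrank : rank w i c + radius w = committeeBound w + j := by omega
    have hbit := Nat.testBit_eq_decide_div_mod_eq (x := Nat.ofBits
      fun j : Fin (radius w + radius w) =>
        decide (∃ c ∈ S, rank w i c + radius w = committeeBound w + j)) (i := j)
    by_cases hlt : j < radius w + radius w
    · rw [Nat.testBit_ofBits_lt _ _ hlt, decide_eq_decide] at hbit
      rw [← hbit]
      constructor
      · rintro ⟨c', hc', h'⟩
        have : c' = c := rank_injective hn i (Nat.add_right_cancel (h'.trans hrank.symm))
        exact this ▸ hc'
      · exact fun hc => ⟨c, hc, hrank⟩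
    -- Beyond the window the mask has only zero digits, in agreement with the upper rank bound for
    -- members of `S`.
    · rw [Nat.testBit_ofBits_ge _ _ (not_lt.1 hlt)] at hbit
      constructor
      · intro h'; simp [h'] at hbit
      · intro hc
        have := (hS c).2 hc
        omega

end

/-! ### The encoding -/

variable (J : VotingInstance)

/-- The input of the program. -/
def input (j : ℕ) : ℕ := J.encode.getD j 0

theorem input_zero : input J 0 = J.numAgents := rfl
theorem input_one : input J 1 = J.numCandidates := rfl
theorem input_two : input J 2 = J.numProfiles := rfl
theorem input_three : input J 3 = J.k := rfl
theorem input_four : input J 4 = J.x := rfl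
theorem input_five : input J 5 = J.ℓ := rfl

theorem getD_flatten_ofFn {a τ : ℕ} (g : Fin τ → Fin a → ℕ) (i : Fin τ) (v : Fin a) :
    (List.ofFn fun i => List.ofFn fun v => g i v).flatten.getD (i * a + v) 0 = g i v := by
  have ha : 0 < a := v.pos
  have h := List.ofFn_mul (m := τ) (n := a) fun x =>
    g ⟨x / a, Nat.div_lt_of_lt_mul (x.2.trans_eq (mul_comm τ a))⟩ ⟨x % a, Nat.mod_lt _ ha⟩
  have hdiv : ∀ (i : Fin τ) (v : Fin a), ((i : ℕ) * a + v) / a = i := fun i v => by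
    rw [mul_comm, Nat.mul_add_div ha, Nat.div_eq_of_lt v.2, add_zero]
  have hmod : ∀ (i : Fin τ) (v : Fin a), ((i : ℕ) * a + v) % a = v := fun i v => by
    rw [mul_comm, Nat.mul_add_mod, Nat.mod_eq_of_lt v.2]
  simp only [hdiv, hmod, Fin.eta] at h
  rw [← h]
  have hlt : (i : ℕ) * a + v < τ * a := by
    calc (i : ℕ) * a + v < i * a + a := by omega
      _ = (i + 1) * a := by ring
      _ ≤ τ * a := by gcongr; exact i.2
  rw [List.getD_eq_getElem _ _ (by simpa using hlt)]
  simp [hdiv, hmod]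

theorem vote_input (i : Fin J.numProfiles) (v : Fin J.numAgents) :
    vote (input J) i v = VotingInstance.voteCode (J.profile i v) := by
  rw [vote, input_zero, input_one, input_two, input, VotingInstance.encode,
    List.getD_append_right _ _ _ _ (by simp; omega)]
  rw [← getD_flatten_ofFn (fun i v => VotingInstance.voteCode (J.profile i v)) i v]
  congr 1
  simp
  omega

theorem length_le_wordLength {l : List ℕ} : l.length ≤ wordLength l := by
  unfold wordLength
  induction l with
  | nil => simp
  | cons n l ih => simp; omega

theorem size_lt_wordLength {l : List ℕ} {m : ℕ} (h : m ∈ l) : m.size < wordLength l := by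
  unfold wordLength
  have := List.single_le_sum (l := l.map fun n => n.size + 1) (by simp) (m.size + 1)
    (List.mem_map.2 ⟨m, h, rfl⟩)
  omega

theorem size_bounds : 6 + J.numAgents + J.numCandidates + J.numProfiles ≤ J.size := by
  refine le_trans ?_ length_le_wordLength
  simp [VotingInstance.encode]
  omega

theorem size_input_le (j : ℕ) : (input J j).size ≤ J.size := by
  by_cases hj : j < J.encode.length
  · rw [input, List.getD_eq_getElem _ _ hj]
    exact (size_lt_wordLength (List.getElem_mem hj)).le
  · rw [input, List.getD_eq_default _ _ (not_lt.1 hj)]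
    simp

/-- Agents, candidates and profiles are listed explicitly, so their names are bounded by the length
of the word. This fails for `k`, `x` and `ℓ`, which are among the first six entries. -/
theorem input_le {j : ℕ} (hj : 6 ≤ j) : input J j ≤ J.size := by
  have hb := size_bounds J
  have hmem : ∀ m ∈ List.range' 1 J.numAgents ++ List.range' 1 J.numCandidates ++
      List.range' 1 J.numProfiles ++ (List.ofFn fun i => List.ofFn fun v =>
        VotingInstance.voteCode (J.profile i v)).flatten, m ≤ J.size := by
    intro m hm
    simp only [List.mem_append, List.mem_range'_1, List.mem_flatten, List.mem_ofFn] at hm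
    rcases hm with ((hm | hm) | hm) | ⟨l, ⟨i, rfl⟩, hm⟩
    · omega
    · omega
    · omega
    · rw [List.mem_ofFn] at hm
      obtain ⟨v, rfl⟩ := hm
      rcases J.profile i v with _ | c
      · simp [VotingInstance.voteCode]
      · have := c.2
        simp only [VotingInstance.voteCode]
        omega
  rw [input, VotingInstance.encode, List.append_assoc, List.append_assoc, List.append_assoc,
    List.getD_append_right _ _ _ _ (by simpa using hj)]
  set l := List.range' 1 J.numAgents ++ (List.range' 1 J.numCandidates ++
      (List.range' 1 J.numProfiles ++ (List.ofFn fun i => List.ofFn fun v =>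
        VotingInstance.voteCode (J.profile i v)).flatten)) with hl
  by_cases hlt : j - [J.numAgents, J.numCandidates, J.numProfiles, J.k, J.x, J.ℓ].length < l.length
  · rw [List.getD_eq_getElem _ _ hlt]
    refine hmem _ ?_
    rw [List.append_assoc, List.append_assoc]
    exact List.getElem_mem hlt
  · rw [List.getD_eq_default _ _ (not_lt.1 hlt)]
    omega

/-! ### Correctness -/

theorem weight_eq (i : Fin J.numProfiles) (c : Fin J.numCandidates) :
    weight (input J) i c = (Finset.univ.filter fun v => J.profile i v = some c).card := by
  rw [weight, input_zero, Finset.sum_range, Finset.card_filter]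
  refine Finset.sum_congr rfl fun v _ => ?_
  rw [vote_input]
  congr 1
  rcases J.profile i v with _ | c'
  · simp [VotingInstance.voteCode]
  · simp [VotingInstance.voteCode, Fin.ext_iff]

/-- The number of votes for a committee. -/
theorem card_votes (i : Fin J.numProfiles) (S : Finset (Fin J.numCandidates)) :
    (Finset.univ.filter fun v => ∃ c ∈ S, J.profile i v = some c).card =
      ∑ c ∈ S, weight (input J) i c := by
  have : (Finset.univ.filter fun v => ∃ c ∈ S, J.profile i v = some c) =
      S.biUnion fun c => Finset.univ.filter fun v => J.profile i v = some c := by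
    ext v; simp
  rw [this, Finset.card_biUnion]
  · exact Finset.sum_congr rfl fun c _ => (weight_eq J i c).symm
  · intro c _ c' _ hne
    refine Finset.disjoint_left.2 fun v hv hv' => hne ?_
    simp only [Finset.mem_filter, Finset.mem_univ, true_and] at hv hv'
    exact Option.some_injective _ (hv.symm.trans hv')

theorem score_eq (i : Fin J.numProfiles) (m : ℕ) :
    score (input J) i m = (Finset.univ.filter fun v =>
      ∃ c ∈ committee (input J) J.numCandidates i m, J.profile i v = some c).card := by
  rw [score, input_zero, Finset.sum_range, Finset.card_filter]
  refine Finset.sum_congr rfl fun v _ => ?_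
  rw [vote_input]
  rcases J.profile i v with _ | c
  · simp [VotingInstance.voteCode]
  · simp [VotingInstance.voteCode, member_eq]

/-- Capping is harmless: no committee has more than `J.numCandidates` members, and a demand for more
votes than there are agents stays unsatisfiable when lowered to `J.numAgents + 1`. -/
theorem valid_iff (i : Fin J.numProfiles) (m : ℕ) :
    Valid (input J) i m ↔ (committee (input J) J.numCandidates i m).card ≤ J.k ∧
      J.x ≤ (Finset.univ.filter fun v =>
        ∃ c ∈ committee (input J) J.numCandidates i m, J.profile i v = some c).card := by
  rw [Valid, committeeSize_eq (input_one J), score_eq, committeeBound, voteBound, input_three,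
    input_one, input_four, input_zero]
  have h1 := (committee (input J) J.numCandidates i m).card_le_univ
  have h2 := (Finset.univ.filter fun v =>
    ∃ c ∈ committee (input J) J.numCandidates i m, J.profile i v = some c).card_le_univ
  rw [Fintype.card_fin] at h1 h2
  omega

/-- The symmetric difference has at most twice as many elements as a committee may have, so a larger
`ℓ` can be lowered to that number plus one without becoming attainable. This cap is what makes the
running time depend on `k` alone when `ℓ` is large. -/
theorem diffBound_le_iff {S T : Finset (Fin J.numCandidates)} (hS : S.card ≤ J.k)
    (hT : T.card ≤ J.k) :
    diffBound (input J) ≤ (symmDiff S T).card ↔ J.ℓ ≤ (symmDiff S T).card := by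
  rw [diffBound, committeeBound, input_three, input_one, input_five]
  have h1 := S.card_le_univ
  have h2 := T.card_le_univ
  have h3 : (symmDiff S T).card ≤ S.card + T.card :=
    (Finset.card_le_card (by
      intro c hc
      rw [Finset.mem_symmDiff] at hc
      rw [Finset.mem_union]
      tauto)).trans (Finset.card_union_le S T)
  rw [Fintype.card_fin] at h1 h2
  omega

theorem isYes_of_reachable (h : input J 2 = 0 ∨
    ∃ m < numMasks (input J), Reachable (input J) (input J 2 - 1) m) : J.IsYes := by
  rw [input_two] at h
  by_cases hτ : J.numProfiles = 0
  · exact ⟨fun i => ∅, fun i => absurd i.2 (by omega), fun i => absurd i.2 (by omega)⟩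
  · obtain ⟨m, -, hm⟩ := h.resolve_left hτ
    obtain ⟨f, -, hv, hd⟩ := hm.exists_sequence
    have hv' := fun i : Fin J.numProfiles => (valid_iff J i (f i)).1 (hv i (by omega))
    refine ⟨fun i => committee (input J) J.numCandidates i (f i), fun i => ?_, fun i j hij => ?_⟩
    · convert hv' i
    have := hd i (by omega)
    rw [difference_eq (input_one J), ← hij, diffBound_le_iff J (hv' j).1 (hv' i).1,
      symmDiff_comm] at this
    exact this

theorem reachable_of_isYes (h : J.IsYes) : input J 2 = 0 ∨
    ∃ m < numMasks (input J), Reachable (input J) (input J 2 - 1) m := by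
  rw [input_two]
  refine or_iff_not_imp_left.2 fun hτ => ?_
  obtain ⟨S₀, hS₀, hd₀⟩ := h
  have hk : committeeBound (input J) ≤ J.numCandidates := by
    rw [committeeBound, input_one]; exact min_le_right _ _
  have hcard₀ : ∀ i, (S₀ i).card ≤ committeeBound (input J) := by
    intro i
    have h2 := (S₀ i).card_le_univ
    rw [Fintype.card_fin] at h2
    rw [committeeBound, input_three, input_one]
    exact le_min (hS₀ i).1 h2
  -- The exchange argument is applied to the capped size and distance, so that its window is the one
  -- the masks cover.
  obtain ⟨S, ⟨hS, hd⟩, hrank⟩ := exists_feasible_near_top (τ := J.numProfiles)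
    (x := J.x) (ℓ := diffBound (input J))
    (rank := fun i c => rank (input J) i c) (wt := fun i c => weight (input J) i c)
    (fun i c => rank_lt (input_one J) i c) (fun i j hj => card_rank_lt (input_one J) i hj)
    (fun i p q hpq => weight_le_of_rank_lt (input_one J) i hpq) hk
    ⟨S₀, fun i => ⟨hcard₀ i, by rw [← card_votes]; convert (hS₀ i).2⟩,
      fun i j hij => (diffBound_le_iff J (hS₀ i).1 (hS₀ j).1).2 (hd₀ i j hij)⟩
  have hmask := fun i : Fin J.numProfiles => exists_mask (input_one J) i (S i) (hrank i)
  choose f hf hfS using hmask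
  have hcard : ∀ i, (S i).card ≤ J.k := fun i =>
    (hS i).1.trans (by rw [committeeBound, input_three]; exact min_le_left _ _)
  have hreach := reachable_of_sequence (w := input J) (τ := J.numProfiles)
    (f := fun j => if h : j < J.numProfiles then f ⟨j, h⟩ else 0)
    (fun j hj => by rw [dif_pos hj]; exact hf _)
    (fun j hj => by
      rw [dif_pos hj]
      refine (valid_iff J ⟨j, hj⟩ _).2 ?_
      rw [hfS ⟨j, hj⟩, card_votes]
      exact ⟨hcard _, (hS _).2⟩)
    (fun j hj => by
      rw [dif_pos hj, dif_pos (by omega), difference_eq (input_one J)]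
      have h1 := hfS ⟨j + 1, hj⟩
      have h2 := hfS ⟨j, by omega⟩
      simp only at h1 h2
      rw [h1, h2, symmDiff_comm]
      exact hd _ _ rfl)
    (J.numProfiles - 1) (by omega)
  refine ⟨_, ?_, hreach⟩
  rw [dif_pos (by omega)]
  exact hf _

/-! ### The running time in terms of the input size and the parameters. -/

theorem program_answers : ∃ t s, RamExec program (RamState.init J.encode) t s ∧
    t ≤ (32 * numMasks (input J) * J.size) ^ 302 ∧
    (J.IsYes → s.var 0 = 1) ∧ (¬ J.IsYes → s.var 0 = 0) := by
  -- This `Q` exceeds the number of masks, the number of table entries and all bounded input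
  -- entries; it also exceeds the window width, since that is less than two to its own power.
  obtain ⟨Q, hQ⟩ : ∃ Q, Q = 32 * numMasks (input J) * J.size := ⟨_, rfl⟩
  have hb := size_bounds J
  have hM := numMasks_pos (input J)
  have h1 : J.size ≤ numMasks (input J) * J.size := Nat.le_mul_of_pos_left _ hM
  have h2 : numMasks (input J) ≤ numMasks (input J) * J.size :=
    Nat.le_mul_of_pos_right _ (by omega)
  have h3 : radius (input J) + radius (input J) < numMasks (input J) := Nat.lt_two_pow_self
  have h4 : J.numProfiles * numMasks (input J) ≤ numMasks (input J) * J.size := by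
    rw [mul_comm]; gcongr; omega
  rw [mul_assoc] at hQ
  have : Fact (32 ≤ Q) := ⟨by omega⟩
  have I : Input Q (input J) (RamState.init J.encode) :=
    { arr := by funext j; simp [RamState.init, input]
      table := by intro j; simp [RamState.init]
      agents := by rw [input_zero]; omega
      candidates := by rw [input_one]; omega
      profiles := by rw [input_two]; omega
      size := fun j => (size_input_le J j).trans (by omega)
      votes := fun j hj => (input_le J hj).trans (by omega)
      radius := by rw [input_one]; omega
      masks := by omega }
  obtain ⟨t, s, A, e1, e2, e3, e4⟩ := program_correct I (by rw [input_two]; omega)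
  have ha := answer_correct e4
  refine ⟨t, s, e1, ?_, fun h => ?_, fun h => ?_⟩
  · rw [mul_assoc, ← hQ]; exact e2
  · rw [e3]; exact ha.1 (reachable_of_isYes J h)
  · rw [e3]; exact ha.2 fun h' => h (isYes_of_reachable J h')

/-- The exponent `16 * p` is relaxed to `26 * p` so that one constant serves both factors of the
final bound. -/
theorem pow_bound {m σ p E : ℕ} (h : m ≤ 2 ^ (16 * p) * σ ^ 25) :
    (m * σ) ^ E ≤ 2 ^ (E * 26 * p) * σ ^ (E * 26) := by
  calc (m * σ) ^ E ≤ (2 ^ (26 * p) * σ ^ 26) ^ E := by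
        refine Nat.pow_le_pow_left ?_ _
        rw [pow_succ σ 25, ← mul_assoc]
        refine Nat.mul_le_mul_right _ (h.trans (Nat.mul_le_mul_right _ ?_))
        exact Nat.pow_le_pow_right (by norm_num) (by omega)
    _ = 2 ^ (E * 26 * p) * σ ^ (E * 26) := by
        rw [mul_pow, ← pow_mul, ← pow_mul]
        congr 2 <;> ring

/-- The running time in terms of a parameter `p` that bounds the exponent. -/
theorem program_answersWithin {p : ℕ} (hp : 8 * diffBound (input J) ≤ 16 * p + 8) :
    program.AnswersWithin J.encode J.IsYes (2 ^ (302 * 26 * p) * J.size ^ (302 * 26)) := by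
  obtain ⟨t, s, e1, e2, e3⟩ := program_answers J
  refine ⟨t, s, e1, e2.trans ?_, e3⟩
  have hb := size_bounds J
  have hmask : 32 * numMasks (input J) ≤ 2 ^ (16 * p) * J.size ^ 25 := by
    calc 32 * numMasks (input J) = 2 ^ (5 + (radius (input J) + radius (input J))) := by
          rw [numMasks, pow_add 2 5]; norm_num
      -- Twice the radius is `8 * diffBound + 12`, and the factor `32` adds `5`; the constant part
      -- `2 ^ 25` is then absorbed by `J.size ^ 25`.
      _ ≤ 2 ^ (16 * p + 25) := Nat.pow_le_pow_right (by norm_num) (by unfold radius; omega)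
      _ = 2 ^ (16 * p) * 2 ^ 25 := pow_add _ _ _
      _ ≤ 2 ^ (16 * p) * J.size ^ 25 := by gcongr; omega
  exact pow_bound hmask

end CommitteeAlgorithm

/-- Diverse Multistage Plurality Voting can be decided in time `2 ^ O(ℓ) * |J| ^ O(1)`; moreover,
it can be decided in time `2 ^ O(k) * |J| ^ O(1)`. -/
theorem mainTheorem5 :
    (∃ (P : RamProgram) (c : ℕ), ∀ J : VotingInstance,
      P.AnswersWithin J.encode J.IsYes (2 ^ (c * J.ℓ) * J.size ^ c)) ∧
    (∃ (P : RamProgram) (c : ℕ), ∀ J : VotingInstance,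
      P.AnswersWithin J.encode J.IsYes (2 ^ (c * J.k) * J.size ^ c)) := by
  refine ⟨⟨CommitteeAlgorithm.program, 302 * 26, fun J => ?_⟩,
    ⟨CommitteeAlgorithm.program, 302 * 26, fun J => ?_⟩⟩
  · refine CommitteeAlgorithm.program_answersWithin J ?_
    rw [CommitteeAlgorithm.diffBound, CommitteeAlgorithm.input_five]
    omega
  -- Here the capped distance is at most `2 * k + 1`, which accounts for the form `16 * p + 8` of
  -- the hypothesis.
  · refine CommitteeAlgorithm.program_answersWithin J ?_
    rw [CommitteeAlgorithm.diffBound, CommitteeAlgorithm.committeeBound,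
      CommitteeAlgorithm.input_three]
    omega
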